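/- **Setting.** There are finitely many bidders, listed in a fixed (arbitrary) lexicographic order; bidder $i$ has a true maximum cost-per-click $m_i>0$ and a true budget $B_i>0$. There are $n'$ slots with $D_1>D_2>\dots>D_{n'}\ge 0$ clicks; put $D_j=0$ for $j>n'$. For a real vector $v$ indexed by the bidders write $v_i\succ v_j$ if $v_i>v_j$, or $v_i=v_j$ and $i$ comes first lexicographically. A *feasible schedule* assigns to each bidder a finite set of pairs (slot $j$, interval $[\alpha,\beta)\subseteq[0,1]$, $\alpha<\beta$) such that the intervals of each slot are disjoint and the intervals of each bidder are disjoint; a bidder receives the sum of $(\beta-\alpha)D_j$ over her pairs as clicks. *Greedy first-price (GFP) mechanism.* Given declared bids $b_i\ge0$ and declared budgets, the bidders are treated in the order $\succ$ of their bids. Each bidder $i$ receives the largest number of clicks that a feasible schedule can give her at price $b_i$ per click within her declared budget, while all earlier bidders receive exactly the clicks already committed to them. Bidder $i$ pays $b_i$ per click. Her utility is her number $c_i$ of clicks if $b_i\le m_i$ and $b_ic_i\le B_i$ (true values), and $-\infty$ otherwise. A profile of declared bids and budgets is a *pure-strategy $\epsilon$-Nash equilibrium* if no bidder can increase her utility by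 more than $\epsilon$ by changing her nonnegative declared bid and budget while all other declarations stay fixed. *Price-setting (PS) mechanism.* For a set of bidders with given budgets, sorted by decreasing budget, and a sequence of remaining slots, *Find-Price-Block* computes the ratios $r_\ell$ (sum of the $\ell$ largest budgets over the sum of the clicks of the first $\ell$ remaining slots), the price $p=\max_\ell r_\ell$, and the block consisting of the $\ell^*$ bidders with the largest budgets, where $\ell^*$ is the largest $\ell$ with $r_\ell=p$; each bidder in the block receives (budget)$/p$ clicks. The PS mechanism on bids $m_i$ and budgets $B_i$ repeats the following while bidders and slots with positive clicks remain. Sort the remaining bidders as $m_1\succ m_2\succ\cdots$; let $k$ be the first index for which Find-Price-Block on bidders $1,\dots,k$ gives a price $p\ge m_{k+1}$ (with $m_{k+1}:=0$ if there is no further bidder); reduce the budget of bidder $k$, as little as possible, until Find-Price-Block on $1,\dots,k$ gives a price at most $m_k$; apply this allocation, and remove the $\ell^*$ bidders of the block and the first $\ell^*$ remaining slots. Let $c_i$ be the clicks that bidder $i$ receives and $p(i)$ the price of her block ($c_i=0$ and $p(i)=0$ for bidders that are left when no slot with positive clicks remains). **Theorem.** Suppose the PS mechanism is run on the truthful input,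 resulting in clicks $c_i$ and block prices $p(i)$. Then for every $\epsilon>0$, for all sufficiently small $\epsilon'>0$, the profile in which every bidder $i$ declares the bid $\min\{m_i,\,p(i)+\epsilon'\}$ and her true budget $B_i$ is a pure-strategy $\epsilon$-Nash equilibrium of the GFP mechanism, and in it every bidder $i$ receives between $c_i-\epsilon$ and $c_i+\epsilon$ clicks. -/

import Mathlib

namespace AdSlots

/-- `Precedes v i j` is the relation `v i ≻ v j`: bidder `i` has the larger value, or the values are
equal and `i` comes first in the fixed lexicographic order of the bidders (the order of `ι`). -/
def Precedes {ι : Type*} [LinearOrder ι] (v : ι → ℝ) (i j : ι) : Prop :=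
  v j < v i ∨ (v i = v j ∧ i < j)

open Classical in
/-- The number of bidders in `A` that come before `i` when `A` is sorted by decreasing `v`. -/
noncomputable def rank {ι : Type*} [LinearOrder ι] (v : ι → ℝ) (A : Finset ι) (i : ι) : ℕ :=
  (A.filter fun j => Precedes v j i).card

/-- The first `l` bidders of `A` when `A` is sorted by decreasing `v`. -/
noncomputable def top {ι : Type*} [LinearOrder ι] (v : ι → ℝ) (A : Finset ι) (l : ℕ) : Finset ι :=
  A.filter fun i => rank v A i < l

theorem rank_lt_rank {ι : Type*} [LinearOrder ι] [Fintype ι] {v : ι → ℝ} {i j : ι}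
    (h : Precedes v j i) : rank v Finset.univ j < rank v Finset.univ i := by
  classical
  unfold rank
  apply Finset.card_lt_card
  rw [Finset.ssubset_iff_of_subset]
  · refine ⟨j, by simpa using h, fun hj => ?_⟩
    have hj' : Precedes v j j := (Finset.mem_filter.1 hj).2
    rcases hj' with hj' | ⟨_, hj'⟩
    · exact lt_irrefl _ hj'
    · exact lt_irrefl _ hj'
  · intro k hk
    simp only [Finset.mem_filter, Finset.mem_univ, true_and] at hk ⊢
    unfold Precedes at *
    rcases h with h | ⟨h, h'⟩ <;> rcases hk with hk | ⟨hk, hk'⟩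
    · exact Or.inl (h.trans hk)
    · exact Or.inl (by rw [hk]; exact h)
    · exact Or.inl (by rw [← h]; exact hk)
    · exact Or.inr ⟨hk.trans h, hk'.trans h'⟩

/-! ### Schedules -/

/-- A pair (slot `slot`, time interval `[start, finish)`). -/
structure Placement (n' : ℕ) where
  slot : Fin n'
  start : ℝ
  finish : ℝ

/-- A schedule assigns to each bidder a finite set of (slot, time interval) pairs. -/
abbrev Schedule (ι : Type*) (n' : ℕ) := ι → Finset (Placement n')

/-- All time intervals are nonempty and contained in `[0, 1]`, and any two different placements
that share the bidder or the slot have disjoint time intervals. -/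
def Feasible {ι : Type*} {n' : ℕ} (S : Schedule ι n') : Prop :=
  (∀ i, ∀ a ∈ S i, 0 ≤ a.start ∧ a.start < a.finish ∧ a.finish ≤ 1) ∧
  ∀ i, ∀ a ∈ S i, ∀ i', ∀ a' ∈ S i', (i, a) ≠ (i', a') → (i = i' ∨ a.slot = a'.slot) →
    Disjoint (Set.Ico a.start a.finish) (Set.Ico a'.start a'.finish)

/-- The number of clicks that bidder `i` receives from a schedule. -/
noncomputable def scheduleClicks {ι : Type*} {n' : ℕ} (D : Fin n' → ℝ) (S : Schedule ι n')
    (i : ι) : ℝ :=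
  ∑ a ∈ S i, (a.finish - a.start) * D a.slot

/-! ### The greedy first-price mechanism -/

/-- The clicks given to bidder `i` by the greedy first-price mechanism on the declared bids `b` and
declared budgets `B`: in decreasing order of the bids, every bidder receives the largest number of
clicks that some feasible schedule can give her within her budget at a price of `b i` per click,
while the bidders before her receive exactly the clicks already committed to them. -/
noncomputable def gfpClicks {ι : Type*} [LinearOrder ι] [Fintype ι] {n' : ℕ} (D : Fin n' → ℝ)
    (b B : ι → ℝ) (i : ι) : ℝ :=
  sSup {x : ℝ | b i * x ≤ B i ∧ ∃ S : Schedule ι n', Feasible S ∧ scheduleClicks D S i = x ∧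
    ∀ j, Precedes b j i → scheduleClicks D S j = gfpClicks D b B j}
termination_by rank b Finset.univ i
decreasing_by exact rank_lt_rank ‹_›

open Classical in
/-- The utility of a bidder with true max-cpc `m` and true budget `B` who receives `c` clicks at a
price of `p` per click. -/
noncomputable def utility (m B c p : ℝ) : EReal :=
  if p ≤ m ∧ c * p ≤ B then (c : EReal) else ⊥

/-- The utility of bidder `i`, with true max-cpc's `m` and budgets `B`, in the greedy first-price
mechanism on the declared bids `b` and budgets `B'`; her price per click is her bid. -/
noncomputable def gfpUtility {ι : Type*} [LinearOrder ι] [Fintype ι] {n' : ℕ} (D : Fin n' → ℝ)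
    (m B b B' : ι → ℝ) (i : ι) : EReal :=
  utility (m i) (B i) (gfpClicks D b B' i) (b i)

/-- The declared bids `b` and budgets `B'` form a pure-strategy `ε`-Nash equilibrium of the greedy
first-price mechanism for bidders with true max-cpc's `m` and true budgets `B`. -/
def IsEpsNash {ι : Type*} [LinearOrder ι] [Fintype ι] {n' : ℕ} (D : Fin n' → ℝ)
    (m B : ι → ℝ) (ε : ℝ) (b B' : ι → ℝ) : Prop :=
  ∀ i : ι, ∀ x y : ℝ, 0 ≤ x → 0 ≤ y →
    gfpUtility D m B (Function.update b i x) (Function.update B' i y) i ≤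
      gfpUtility D m B b B' i + (ε : EReal)

/-! ### The price-setting mechanism

Slots are numbered from `0`. The slots used so far are `0, …, s - 1`, and slots with zero clicks
are added after the last slot. -/

/-- The clicks of the slots, followed by dummy slots with zero clicks. -/
noncomputable def padded {n' : ℕ} (D : Fin n' → ℝ) (j : ℕ) : ℝ :=
  if h : j < n' then D ⟨j, h⟩ else 0

/-- The ratio `r_l` of Find-Price-Block on the bidders `A` with budgets `B` and the slots
`s, s + 1, …`: the sum of the `l` largest budgets over the clicks of the first `l` slots. -/
noncomputable def ratio {ι : Type*} [LinearOrder ι] {n' : ℕ} (D : Fin n' → ℝ) (B : ι → ℝ)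
    (A : Finset ι) (s l : ℕ) : ℝ :=
  (∑ i ∈ top B A l, B i) / ∑ j ∈ Finset.range l, padded D (s + j)

/-- The price of Find-Price-Block: the maximum of the ratios `r_1, …, r_|A|`. -/
noncomputable def blockPrice {ι : Type*} [LinearOrder ι] {n' : ℕ} (D : Fin n' → ℝ) (B : ι → ℝ)
    (A : Finset ι) (s : ℕ) : ℝ :=
  sSup (ratio D B A s '' Set.Icc 1 A.card)

open Classical in
/-- The length of the block of Find-Price-Block: the largest `l` whose ratio is the price. -/
noncomputable def blockLength {ι : Type*} [LinearOrder ι] {n' : ℕ} (D : Fin n' → ℝ) (B : ι → ℝ)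
    (A : Finset ι) (s : ℕ) : ℕ :=
  Nat.findGreatest (fun l => 1 ≤ l ∧ ratio D B A s l = blockPrice D B A s) A.card

/-- Among the remaining bidders `R`, sorted by decreasing bid, the first `k ≥ 1` such that
Find-Price-Block on the first `k` bidders gives a price of at least the bid of the next one
(no condition if there is no next one, as if that bid were zero). -/
noncomputable def stopIndex {ι : Type*} [LinearOrder ι] {n' : ℕ} (D : Fin n' → ℝ) (m B : ι → ℝ)
    (R : Finset ι) (s : ℕ) : ℕ :=
  sInf {k : ℕ | 1 ≤ k ∧ ∀ i ∈ R, rank m R i = k → m i ≤ blockPrice D B (top m R k) s}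

open Classical in
/-- The budgets after the budget of the `k`-th bidder, `k = stopIndex`, has been reduced (as little
as possible, possibly not at all) until Find-Price-Block on the first `k` bidders gives a price of
at most the bid of the `k`-th one. -/
noncomputable def reducedBudget {ι : Type*} [LinearOrder ι] {n' : ℕ} (D : Fin n' → ℝ)
    (m B : ι → ℝ) (R : Finset ι) (s : ℕ) (i : ι) : ℝ :=
  if rank m R i + 1 = stopIndex D m B R s then
    sSup {x : ℝ | 0 ≤ x ∧ x ≤ B i ∧
      blockPrice D (Function.update B i x) (top m R (stopIndex D m B R s)) s ≤ m i}
  else B i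

/-- The state of the price-setting mechanism: the remaining bidders, the number of slots already
allocated, and the clicks and the price of the block of each bidder allocated so far. -/
structure PSState (ι : Type*) where
  remaining : Finset ι
  used : ℕ
  clicks : ι → ℝ
  price : ι → ℝ

open Classical in
/-- One round of the price-setting mechanism, which allocates one price block. If no bidder remains
or all the remaining slots have zero clicks, nothing is left to be done. -/
noncomputable def psRound {ι : Type*} [LinearOrder ι] {n' : ℕ} (D : Fin n' → ℝ) (m B : ι → ℝ)
    (σ : PSState ι) : PSState ι :=
  if σ.remaining = ∅ ∨ ∀ j, σ.used ≤ j → padded D j = 0 then σ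
  else
    let A := top m σ.remaining (stopIndex D m B σ.remaining σ.used)
    let B' := reducedBudget D m B σ.remaining σ.used
    let p := blockPrice D B' A σ.used
    let l := blockLength D B' A σ.used
    let P := top B' A l
    { remaining := σ.remaining \ P
      used := σ.used + l
      clicks := fun i => if i ∈ P then B' i / p else σ.clicks i
      price := fun i => if i ∈ P then p else σ.price i }

/-- The final state of the price-setting mechanism on the bids `m` and the budgets `B`. Every round
allocates at least one bidder, so as many rounds as there are bidders suffice. Bidders that are left
without a slot of positive clicks have zero clicks and the price zero. -/
noncomputable def psFinal {ι : Type*} [LinearOrder ι] [Fintype ι] {n' : ℕ} (D : Fin n' → ℝ)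
    (m B : ι → ℝ) : PSState ι :=
  (psRound D m B)^[Fintype.card ι] ⟨Finset.univ, 0, fun _ => 0, fun _ => 0⟩

/-- The clicks that the price-setting mechanism gives to each bidder. -/
noncomputable def psClicks {ι : Type*} [LinearOrder ι] [Fintype ι] {n' : ℕ} (D : Fin n' → ℝ)
    (m B : ι → ℝ) : ι → ℝ :=
  (psFinal D m B).clicks

/-- The price of each bidder's block in the price-setting mechanism. -/
noncomputable def psPrice {ι : Type*} [LinearOrder ι] [Fintype ι] {n' : ℕ} (D : Fin n' → ℝ)
    (m B : ι → ℝ) : ι → ℝ :=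
  (psFinal D m B).price

end AdSlots

/-! Write `capacity D l` for the total clicks of the first `l` slots. Because the slot sizes
decrease, this is concave in `l`, hence submodular as a function of sets of bidders. Feasible
schedules realise exactly the nonnegative click vectors that give every set `T` at most `capacity D
T.card` (`Feasible.sum_le`, `exists_schedule`). So the greedy mechanism is a greedy algorithm on a
polymatroid with extra budget caps: a bidder stops either at her budget or because she lies in a
tight set made of herself and earlier bidders (`gfpClicks_saturated_or_tight`), and tight sets are
closed under union.

What matters about the price-setting outcome is collected in `IsPSOutcome`. Every bidder `i` lies in
a tight set `X` of bidders whose prices are at least `p i`. Either `i` exhausts her budget at price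
`p i`, or the other members of `X` still precede her when she bids `m i`. This rests on block prices
never increasing from round to round, which is proved through `PSInvariant`.

Upper bound, for every admissible deviation (`gfpClicks_update_le`): if `i` exhausts her budget at
`p i`, then a bid of at least `p i` cannot buy more than `c i` clicks. Otherwise all other members
of `X` are served before her. Those who exhaust their budgets at a price raised by at most `ε'`
receive nearly their clicks `c j`; the others are blocked by tight sets. Uncrossing these with `X`
leaves `i` hardly more than `c i` (`gfpClicks_le_of_tight`).

Lower bound: at the proposed profile nobody exceeds `c j` by much, so the polymatroid constraints
leave room for nearly `c i`, and her budget allows this since her price has hardly risen. The two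
bounds give both the equilibrium property and the closeness of the clicks. -/

namespace AdSlots

/-! ### Ranks and initial segments in a sorted set of bidders. -/

section Rank

variable {ι : Type*} [LinearOrder ι] {v : ι → ℝ} {A : Finset ι} {i j : ι} {l : ℕ}

theorem Precedes.irrefl (v : ι → ℝ) (i : ι) : ¬ Precedes v i i := by
  simp [Precedes]

theorem Precedes.trans {k : ι} (h : Precedes v i j) (h' : Precedes v j k) : Precedes v i k := by
  unfold Precedes at *
  rcases h with h | ⟨h, h1⟩ <;> rcases h' with h' | ⟨h', h2⟩
  · exact Or.inl (h'.trans h)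
  · exact Or.inl (h' ▸ h)
  · exact Or.inl (h ▸ h')
  · exact Or.inr ⟨h.trans h', h1.trans h2⟩

theorem Precedes.total (v : ι → ℝ) (h : i ≠ j) : Precedes v i j ∨ Precedes v j i := by
  unfold Precedes
  rcases lt_trichotomy (v i) (v j) with h1 | h1 | h1
  · exact Or.inr (Or.inl h1)
  · rcases lt_or_gt_of_ne h with h2 | h2
    · exact Or.inl (Or.inr ⟨h1, h2⟩)
    · exact Or.inr (Or.inr ⟨h1.symm, h2⟩)
  · exact Or.inl (Or.inl h1)

theorem Precedes.le (h : Precedes v i j) : v j ≤ v i := by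
  rcases h with h | ⟨h, _⟩
  · exact h.le
  · exact h.ge

theorem rank_lt_rank_of_mem (hj : j ∈ A) (h : Precedes v j i) : rank v A j < rank v A i := by
  classical
  unfold rank
  apply Finset.card_lt_card
  rw [Finset.ssubset_iff_of_subset]
  · exact ⟨j, by simp [hj, h], by simp [Precedes.irrefl]⟩
  · intro k hk
    simp only [Finset.mem_filter] at hk ⊢
    exact ⟨hk.1, hk.2.trans h⟩

theorem rank_lt_card (hi : i ∈ A) : rank v A i < A.card := by
  classical
  unfold rank
  apply Finset.card_lt_card
  rw [Finset.ssubset_iff_of_subset (Finset.filter_subset _ _)]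
  exact ⟨i, hi, by simp [Precedes.irrefl]⟩

theorem rank_lt_rank_iff (hi : i ∈ A) (hj : j ∈ A) :
    rank v A j < rank v A i ↔ Precedes v j i := by
  refine ⟨fun h => ?_, rank_lt_rank_of_mem hj⟩
  have hne : j ≠ i := by rintro rfl; exact lt_irrefl _ h
  rcases Precedes.total v hne with h' | h'
  · exact h'
  · exact absurd (rank_lt_rank_of_mem hi h') (by omega)

theorem rank_injOn (v : ι → ℝ) (A : Finset ι) : Set.InjOn (rank v A) A := by
  intro i hi j hj h
  by_contra hne
  rcases Precedes.total v hne with h' | h'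
  · exact absurd (rank_lt_rank_of_mem hi h') (by omega)
  · exact absurd (rank_lt_rank_of_mem hj h') (by omega)

theorem image_rank (v : ι → ℝ) (A : Finset ι) : A.image (rank v A) = Finset.range A.card := by
  apply Finset.eq_of_subset_of_card_le
  · intro r hr
    obtain ⟨i, hi, rfl⟩ := Finset.mem_image.1 hr
    exact Finset.mem_range.2 (rank_lt_card hi)
  · rw [Finset.card_range, Finset.card_image_of_injOn (rank_injOn v A)]

theorem exists_rank_eq (v : ι → ℝ) (hl : l < A.card) : ∃ i ∈ A, rank v A i = l := by
  have : l ∈ A.image (rank v A) := by rw [image_rank]; exact Finset.mem_range.2 hl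
  simpa using this

theorem mem_top : i ∈ top v A l ↔ i ∈ A ∧ rank v A i < l := by
  simp [top]

theorem top_subset (v : ι → ℝ) (A : Finset ι) (l : ℕ) : top v A l ⊆ A :=
  Finset.filter_subset _ _

theorem image_rank_top (v : ι → ℝ) (hl : l ≤ A.card) :
    (top v A l).image (rank v A) = Finset.range l := by
  ext r
  simp only [Finset.mem_image, mem_top, Finset.mem_range]
  constructor
  · rintro ⟨i, ⟨_, h⟩, rfl⟩
    exact h
  · intro h
    obtain ⟨i, hi, rfl⟩ := exists_rank_eq v (h.trans_le hl)
    exact ⟨i, ⟨hi, h⟩, rfl⟩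

theorem rank_injOn_top (v : ι → ℝ) (A : Finset ι) (l : ℕ) :
    Set.InjOn (rank v A) (top v A l) :=
  (rank_injOn v A).mono (by exact_mod_cast top_subset v A l)

theorem card_top (v : ι → ℝ) (hl : l ≤ A.card) : (top v A l).card = l := by
  rw [← Finset.card_image_of_injOn (rank_injOn_top v A l), image_rank_top v hl, Finset.card_range]

theorem sum_rank_top (v : ι → ℝ) (hl : l ≤ A.card) (d : ℕ → ℝ) :
    ∑ i ∈ top v A l, d (rank v A i) = ∑ j ∈ Finset.range l, d j := by
  rw [← image_rank_top v hl, Finset.sum_image (rank_injOn_top v A l)]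

theorem top_of_card_le (v : ι → ℝ) (hl : A.card ≤ l) : top v A l = A := by
  ext i
  rw [mem_top]
  exact ⟨fun h => h.1, fun h => ⟨h, (rank_lt_card h).trans_le hl⟩⟩

theorem top_zero (v : ι → ℝ) (A : Finset ι) : top v A 0 = ∅ := by
  ext i; simp [mem_top]

theorem mem_top_succ_iff (hi : i ∈ A) (hj : j ∈ A) :
    j ∈ top v A (rank v A i + 1) ↔ j = i ∨ Precedes v j i := by
  rw [mem_top, Nat.lt_succ_iff_lt_or_eq, rank_lt_rank_iff hi hj]
  constructor
  · rintro ⟨_, h | h⟩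
    · exact Or.inr h
    · exact Or.inl (rank_injOn v A hj hi h)
  · rintro (rfl | h)
    · exact ⟨hj, Or.inr rfl⟩
    · exact ⟨hj, Or.inl h⟩

theorem top_succ (hi : i ∈ A) : top v A (rank v A i + 1) = insert i (top v A (rank v A i)) := by
  ext j
  by_cases hj : j ∈ A
  · rw [mem_top_succ_iff hi hj, Finset.mem_insert, mem_top, rank_lt_rank_iff hi hj]
    simp [hj]
  · have : j ≠ i := by rintro rfl; exact hj hi
    simp [mem_top, hj, this]

/-- The first `l` bidders of `A` have the largest total value among the sets of `l` bidders. -/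
theorem sum_le_sum_top (v : ι → ℝ) {T : Finset ι} (hT : T ⊆ A) :
    ∑ i ∈ T, v i ≤ ∑ i ∈ top v A T.card, v i := by
  classical
  rcases T.eq_empty_or_nonempty with rfl | hne
  · simp [top_zero]
  have hpos := hne.card_pos
  have hle := Finset.card_le_card hT
  obtain ⟨a, ha, hra⟩ := exists_rank_eq (A := A) v (l := T.card - 1) (by omega)
  have hcard : T.card = rank v A a + 1 := by omega
  have hct : (top v A T.card).card = T.card := card_top v hle
  -- `a` is the last member of the top set. Relative to the threshold `v a`, terms outside the top
  -- set are nonpositive and those inside are nonnegative; the shift cancels because both sets have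
  -- the same size.
  have key : ∑ i ∈ T, (v i - v a) ≤ ∑ i ∈ top v A T.card, (v i - v a) := by
    calc ∑ i ∈ T, (v i - v a) ≤ ∑ i ∈ T ∩ top v A T.card, (v i - v a) := by
          rw [← Finset.sum_inter_add_sum_sdiff T (top v A T.card)]
          have : ∑ i ∈ T \ top v A T.card, (v i - v a) ≤ 0 := by
            apply Finset.sum_nonpos
            intro i hi
            obtain ⟨hi1, hi2⟩ := Finset.mem_sdiff.1 hi
            rw [hcard, mem_top_succ_iff ha (hT hi1), not_or] at hi2
            have := ((Precedes.total v hi2.1).resolve_left hi2.2).le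
            linarith
          linarith
      _ ≤ _ := by
          apply Finset.sum_le_sum_of_subset_of_nonneg Finset.inter_subset_right
          intro i hi _
          rw [hcard, mem_top_succ_iff ha (top_subset _ _ _ hi)] at hi
          rcases hi with rfl | hi
          · simp
          · linarith [hi.le]
  rw [Finset.sum_sub_distrib, Finset.sum_sub_distrib, Finset.sum_const, Finset.sum_const, hct] at key
  linarith

end Rank

/-! ### Concavity and submodularity of the slot capacity. -/

section Capacity

variable {n' : ℕ} {D : Fin n' → ℝ}

/-- The total number of clicks of the first `l` slots. -/
noncomputable def capacity (D : Fin n' → ℝ) (l : ℕ) : ℝ := ∑ j ∈ Finset.range l, padded D j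

theorem padded_nonneg (hD0 : ∀ j, 0 ≤ D j) (j : ℕ) : 0 ≤ padded D j := by
  unfold padded
  split_ifs
  · exact hD0 _
  · exact le_rfl

theorem padded_antitone (hD : StrictAnti D) (hD0 : ∀ j, 0 ≤ D j) : Antitone (padded D) := by
  intro i j hij
  by_cases hj : j < n'
  · have hi : i < n' := hij.trans_lt hj
    simp only [padded, hi, hj, dite_true]
    exact hD.antitone (by simpa using hij)
  · have : padded D j = 0 := by simp [padded, hj]
    rw [this]
    exact padded_nonneg hD0 i

theorem padded_of_le {j : ℕ} (hj : n' ≤ j) : padded D j = 0 := by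
  simp [padded, Nat.not_lt.2 hj]

theorem capacity_zero : capacity D 0 = 0 := by simp [capacity]

theorem capacity_succ (l : ℕ) : capacity D (l + 1) = capacity D l + padded D l :=
  Finset.sum_range_succ _ _

theorem capacity_add (s l : ℕ) :
    capacity D (s + l) = capacity D s + ∑ j ∈ Finset.range l, padded D (s + j) :=
  Finset.sum_range_add _ _ _

theorem capacity_mono (hD0 : ∀ j, 0 ≤ D j) : Monotone (capacity D) :=
  monotone_nat_of_le_succ fun l => by rw [capacity_succ]; linarith [padded_nonneg hD0 l]

/-- The capacity has decreasing increments. -/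
theorem capacity_add_sub_le (hD : StrictAnti D) (hD0 : ∀ j, 0 ≤ D j) {s s' : ℕ} (h : s ≤ s')
    (l : ℕ) : capacity D (s' + l) - capacity D s' ≤ capacity D (s + l) - capacity D s := by
  rw [capacity_add, capacity_add]
  have : ∑ j ∈ Finset.range l, padded D (s' + j) ≤ ∑ j ∈ Finset.range l, padded D (s + j) :=
    Finset.sum_le_sum fun j _ => padded_antitone hD hD0 (by omega)
  linarith

/-- The shifted capacity is submodular as a set function. -/
theorem capacity_submodular (hD : StrictAnti D) (hD0 : ∀ j, 0 ≤ D j) {ι : Type*} [DecidableEq ι]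
    (s : ℕ) (X Y : Finset ι) :
    capacity D (s + (X ∪ Y).card) + capacity D (s + (X ∩ Y).card) ≤
      capacity D (s + X.card) + capacity D (s + Y.card) := by
  have h1 := Finset.card_union_add_card_inter X Y
  have h2 : (X ∩ Y).card ≤ X.card := Finset.card_le_card Finset.inter_subset_left
  have h3 := capacity_add_sub_le hD hD0 (s := s + (X ∩ Y).card) (s' := s + X.card) (by omega)
    ((X ∪ Y).card - X.card)
  have h4 : X.card ≤ (X ∪ Y).card := Finset.card_le_card Finset.subset_union_left
  rw [show s + X.card + ((X ∪ Y).card - X.card) = s + (X ∪ Y).card by omega,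
    show s + (X ∩ Y).card + ((X ∪ Y).card - X.card) = s + Y.card by omega] at h3
  linarith

end Capacity

/-! ### Feasible schedules as a polymatroid. -/

section Scheduling

variable {ι : Type*} {n' : ℕ} {D : Fin n' → ℝ}

theorem sum_length_le_one {κ : Type*} (I : Finset κ) (f g : κ → ℝ)
    (h : ∀ a ∈ I, 0 ≤ f a ∧ f a < g a ∧ g a ≤ 1)
    (hd : ∀ a ∈ I, ∀ b ∈ I, a ≠ b → Disjoint (Set.Ico (f a) (g a)) (Set.Ico (f b) (g b))) :
    ∑ a ∈ I, (g a - f a) ≤ 1 := by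
  have h1 : MeasureTheory.volume (⋃ a ∈ I, Set.Ico (f a) (g a)) =
      ∑ a ∈ I, MeasureTheory.volume (Set.Ico (f a) (g a)) :=
    MeasureTheory.measure_biUnion_finset (fun a ha b hb hab => hd a ha b hb hab)
      fun _ _ => measurableSet_Ico
  have h2 : MeasureTheory.volume (⋃ a ∈ I, Set.Ico (f a) (g a)) ≤
      MeasureTheory.volume (Set.Icc (0 : ℝ) 1) := by
    apply MeasureTheory.measure_mono
    intro x hx
    simp only [Set.mem_iUnion, Set.mem_Ico] at hx
    obtain ⟨a, ha, hx1, hx2⟩ := hx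
    exact ⟨(h a ha).1.trans hx1, hx2.le.trans (h a ha).2.2⟩
  rw [h1] at h2
  simp only [Real.volume_Ico, Real.volume_Icc, sub_zero] at h2
  rw [← ENNReal.ofReal_sum_of_nonneg (fun a ha => by linarith [(h a ha).2.1])] at h2
  exact (ENNReal.ofReal_le_ofReal_iff zero_le_one).1 h2

/-- Bathtub principle: a total time of `t`, at most one unit per slot, is best spent on the `t`
largest slots. The proof compares each slot with the threshold `padded D t`. -/
theorem sum_mul_le_capacity (hD : StrictAnti D) (hD0 : ∀ j, 0 ≤ D j) (y : Fin n' → ℝ) (t : ℕ)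
    (h0 : ∀ j, 0 ≤ y j) (h1 : ∀ j, y j ≤ 1) (ht : ∑ j, y j ≤ t) :
    ∑ j, y j * D j ≤ capacity D t := by
  have hd : 0 ≤ padded D t := padded_nonneg hD0 t
  have hle : ∀ j : Fin n', y j * (D j - padded D t) ≤
      if (j : ℕ) < t then D j - padded D t else 0 := by
    intro j
    have hj : padded D j = D j := by simp [padded]
    rw [← hj]
    split_ifs with h
    · have := padded_antitone hD hD0 h.le
      nlinarith [h1 j]
    · have := padded_antitone hD hD0 (not_lt.1 h)
      nlinarith [h0 j]
  have h2 : ∑ j : Fin n', (if (j : ℕ) < t then D j - padded D t else 0) =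
      capacity D t - t * padded D t := by
    have e1 : ∑ j : Fin n', (if (j : ℕ) < t then D j - padded D t else 0) =
        ∑ j ∈ Finset.range n', (if j < t then padded D j - padded D t else 0) := by
      rw [Finset.sum_range]
      exact Finset.sum_congr rfl fun j _ => by simp [padded]
    have e2 : capacity D t - t * padded D t = ∑ j ∈ Finset.range t, (padded D j - padded D t) := by
      simp [capacity, Finset.sum_sub_distrib]
    rw [e1, e2, ← Finset.sum_filter]
    apply Finset.sum_subset
    · intro j hj
      simp only [Finset.mem_filter, Finset.mem_range] at hj ⊢
      exact hj.2
    · intro j hj hj'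
      simp only [Finset.mem_filter, Finset.mem_range] at hj hj'
      rw [padded_of_le (j := j) (by omega), padded_of_le (j := t) (by omega), sub_zero]
  calc ∑ j, y j * D j = ∑ j, y j * (D j - padded D t) + (∑ j, y j) * padded D t := by
        rw [Finset.sum_mul, ← Finset.sum_add_distrib]
        exact Finset.sum_congr rfl fun j _ => by ring
    _ ≤ (capacity D t - t * padded D t) + t * padded D t := by
        rw [← h2]
        exact add_le_add (Finset.sum_le_sum fun j _ => hle j)
          (mul_le_mul_of_nonneg_right ht hd)
    _ = _ := by ring

theorem scheduleClicks_nonneg (hD0 : ∀ j, 0 ≤ D j) {S : Schedule ι n'} (hS : Feasible S) (i : ι) :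
    0 ≤ scheduleClicks D S i :=
  Finset.sum_nonneg fun a ha => mul_nonneg (by linarith [(hS.1 i a ha).2.1]) (hD0 _)

/-- In a feasible schedule, `l` bidders together receive at most the clicks of the first `l`
slots. -/
theorem Feasible.sum_le (hD : StrictAnti D) (hD0 : ∀ j, 0 ≤ D j) {S : Schedule ι n'}
    (hS : Feasible S) (T : Finset ι) :
    ∑ i ∈ T, scheduleClicks D S i ≤ capacity D T.card := by
  classical
  -- The time during which slot `j` serves `T`. It is at most 1 because the intervals of a slot are
  -- disjoint, and the total is at most `T.card` because those of a bidder are.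
  let y : Fin n' → ℝ := fun j => ∑ i ∈ T, ∑ a ∈ S i with a.slot = j, (a.finish - a.start)
  have hlen : ∀ i, ∀ a ∈ S i, 0 ≤ a.finish - a.start := fun i a ha => by
    linarith [(hS.1 i a ha).2.1]
  have e : ∑ i ∈ T, scheduleClicks D S i = ∑ j, y j * D j := by
    simp only [y, Finset.sum_mul]
    rw [Finset.sum_comm]
    refine Finset.sum_congr rfl fun i _ => ?_
    rw [scheduleClicks, ← Finset.sum_fiberwise (S i) (fun a => a.slot)]
    refine Finset.sum_congr rfl fun j _ => Finset.sum_congr rfl fun a ha => ?_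
    rw [(Finset.mem_filter.1 ha).2]
  rw [e]
  refine sum_mul_le_capacity hD hD0 y _ ?_ ?_ ?_
  · exact fun j => Finset.sum_nonneg fun i _ => Finset.sum_nonneg fun a ha =>
      hlen i a (Finset.mem_filter.1 ha).1
  · intro j
    simp only [y]
    rw [Finset.sum_sigma']
    refine sum_length_le_one _ (fun a : (_ : ι) × Placement n' => a.2.start) (fun a => a.2.finish)
      ?_ ?_
    · rintro ⟨i, a⟩ h
      simp only [Finset.mem_sigma, Finset.mem_filter] at h
      exact hS.1 i a h.2.1
    · rintro ⟨i, a⟩ h ⟨i', a'⟩ h' hne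
      simp only [Finset.mem_sigma, Finset.mem_filter] at h h'
      refine hS.2 i a h.2.1 i' a' h'.2.1 ?_ (Or.inr (h.2.2.trans h'.2.2.symm))
      intro heq
      simp only [Prod.mk.injEq] at heq
      exact hne (by rw [heq.1, heq.2])
  · simp only [y]
    rw [Finset.sum_comm]
    have : ∀ i ∈ T, ∑ j, ∑ a ∈ S i with a.slot = j, (a.finish - a.start) ≤ 1 := by
      intro i _
      rw [Finset.sum_fiberwise (S i) (fun a => a.slot)]
      refine sum_length_le_one _ _ _ (hS.1 i) ?_
      intro a ha a' ha' hne
      exact hS.2 i a ha i a' ha' (by simpa using hne) (Or.inl rfl)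
    calc _ ≤ ∑ i ∈ T, (1 : ℝ) := Finset.sum_le_sum this
      _ = _ := by simp

/-- Convex combinations of assignments of bidders to distinct slots can be scheduled. -/
theorem exists_schedule_of_convex [Fintype ι] {κ : Type*} [Fintype κ] (w : κ → ℝ)
    (hw : ∀ k, 0 ≤ w k) (hw1 : ∑ k, w k = 1) (g : κ → ι → ℕ) (hg : ∀ k, Function.Injective (g k)) :
    ∃ S : Schedule ι n', Feasible S ∧
      ∀ i, scheduleClicks D S i = ∑ k, w k * padded D (g k i) := by
  classical
  let e := Fintype.equivFin κ
  let ω : ℕ → ℝ := fun r => if h : r < Fintype.card κ then w (e.symm ⟨r, h⟩) else 0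
  have hω : ∀ r, 0 ≤ ω r := fun r => by
    simp only [ω]; split_ifs
    · exact hw _
    · exact le_rfl
  have hωe : ∀ k, ω (e k) = w k := fun k => by simp [ω]
  -- Time sharing: the intervals `[t r, t (r + 1))` of lengths `ω r` fill `[0, 1)`, and each
  -- assignment is used during its own interval.
  let t : ℕ → ℝ := fun r => ∑ q ∈ Finset.range r, ω q
  have htsucc : ∀ r, t (r + 1) = t r + ω r := fun r => Finset.sum_range_succ _ _
  have htm : Monotone t := monotone_nat_of_le_succ fun r => by rw [htsucc]; linarith [hω r]
  have ht1 : t (Fintype.card κ) = 1 := by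
    rw [← hw1]
    simp only [t]
    rw [Finset.sum_range, ← e.sum_comp]
    exact Finset.sum_congr rfl fun k _ => hωe k
  have hdisj : ∀ k k' : κ, k ≠ k' →
      Disjoint (Set.Ico (t (e k)) (t (e k + 1))) (Set.Ico (t (e k')) (t (e k' + 1))) := by
    intro k k' hne
    have : (e k : ℕ) ≠ e k' := fun h => hne (e.injective (Fin.ext h))
    exact htm.pairwise_disjoint_on_Ico_succ this
  -- Weight zero would give an empty interval, which `Feasible` forbids; slot numbers from `n'` on
  -- are dummies. Neither contributes clicks.
  let K : ι → Finset κ := fun i => Finset.univ.filter fun k => 0 < w k ∧ g k i < n'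
  let P : (i : ι) → {k // k ∈ K i} → Placement n' := fun i k =>
    ⟨⟨g k i, ((Finset.mem_filter.1 k.2).2).2⟩, t (e k), t (e k + 1)⟩
  have hlt : ∀ k, 0 < w k → t (e k) < t (e k + 1) := fun k hk => by
    rw [htsucc, hωe]; linarith
  have hne_of : ∀ k k', 0 < w k → t (e k) = t (e k') → t (e k + 1) = t (e k' + 1) → k = k' := by
    intro k k' hk h1 h2
    by_contra hne
    have := hdisj k k' hne
    rw [← h1, ← h2, disjoint_self] at this
    exact (Set.nonempty_Ico.2 (hlt k hk)).ne_empty this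
  refine ⟨fun i => Finset.univ.image (P i), ⟨?_, ?_⟩, ?_⟩
  · intro i a ha
    obtain ⟨⟨k, hk⟩, -, rfl⟩ := Finset.mem_image.1 ha
    have hk' := (Finset.mem_filter.1 hk).2
    refine ⟨(Finset.sum_nonneg fun q _ => hω q : 0 ≤ t (e k)), hlt k hk'.1, ?_⟩
    rw [← ht1]
    exact htm (e k).2
  · intro i a ha i' a' ha' hne hor
    obtain ⟨⟨k, hk⟩, -, rfl⟩ := Finset.mem_image.1 ha
    obtain ⟨⟨k', hk'⟩, -, rfl⟩ := Finset.mem_image.1 ha'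
    apply hdisj
    rintro rfl
    rcases hor with rfl | hor
    · exact hne rfl
    · have : g k i = g k i' := by simpa [P] using hor
      have := hg k this
      subst this
      exact hne rfl
  · intro i
    have hinj : Function.Injective (P i) := by
      rintro ⟨k, hk⟩ ⟨k', hk'⟩ h
      simp only [P, Placement.mk.injEq] at h
      exact Subtype.ext (hne_of k k' (Finset.mem_filter.1 hk).2.1 h.2.1 h.2.2)
    rw [scheduleClicks, Finset.sum_image (fun a _ b _ h => hinj h)]
    have : ∀ k : {k // k ∈ K i}, ((P i k).finish - (P i k).start) * D (P i k).slot =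
        w k * padded D (g k i) := by
      rintro ⟨k, hk⟩
      have hk' := (Finset.mem_filter.1 hk).2
      simp only [P, htsucc, hωe, padded, hk'.2, dite_true]
      ring
    rw [Finset.sum_congr rfl fun k _ => this k]
    rw [Finset.sum_coe_sort (K i) (fun k => w k * padded D (g k i))]
    apply Finset.sum_subset (Finset.subset_univ _)
    intro k _ hk
    simp only [K, Finset.mem_filter, Finset.mem_univ, true_and, not_and] at hk
    by_cases h0 : 0 < w k
    · rw [padded_of_le (not_lt.1 (hk h0)), mul_zero]
    · rw [le_antisymm (not_lt.1 h0) (hw k), zero_mul]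

/-- Abel summation: if all the initial sums of `e` along decreasing values of `w` are nonnegative,
then so is the sum weighted by `w ≥ 0`. -/
theorem sum_mul_nonneg_of_top [LinearOrder ι] (A : Finset ι) (w e : ι → ℝ)
    (h : ∀ l, l ≤ A.card → 0 ≤ ∑ i ∈ top w A l, e i) (l : ℕ) (hl : l ≤ A.card) (q : ℝ)
    (hq : ∀ i ∈ top w A l, q ≤ w i) : 0 ≤ ∑ i ∈ top w A l, (w i - q) * e i := by
  induction l generalizing q with
  | zero => simp [top_zero]
  | succ l ih =>
    obtain ⟨a, ha, rfl⟩ := exists_rank_eq (A := A) w (l := l) (by omega)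
    have ha' : a ∈ top w A (rank w A a + 1) := mem_top.2 ⟨ha, by omega⟩
    have h1 := ih (by omega) (w a) (fun i hi => by
      rw [mem_top] at hi
      exact ((rank_lt_rank_iff ha hi.1).1 hi.2).le)
    have h2 := h _ hl
    -- Raising the threshold from `q` to the smallest weight `w a` kills the term of `a`, so the
    -- induction hypothesis covers what remains.
    have h3 : ∑ i ∈ top w A (rank w A a + 1), (w i - q) * e i =
        ∑ i ∈ top w A (rank w A a), (w i - w a) * e i +
          (w a - q) * ∑ i ∈ top w A (rank w A a + 1), e i := by
      have hna : a ∉ top w A (rank w A a) := by simp [mem_top]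
      have h4 : ∑ i ∈ top w A (rank w A a), (w i - w a) * e i =
          ∑ i ∈ top w A (rank w A a + 1), (w i - w a) * e i := by
        rw [top_succ ha, Finset.sum_insert hna]; simp
      rw [h4, Finset.mul_sum, ← Finset.sum_add_distrib]
      exact Finset.sum_congr rfl fun i _ => by ring
    rw [h3]
    have := mul_nonneg (sub_nonneg.2 (hq a ha')) h2
    linarith

/-- Click vectors within the capacities of all sets of bidders can be scheduled. -/
theorem exists_schedule [Fintype ι] [LinearOrder ι] (c : ι → ℝ) (hc0 : ∀ i, 0 ≤ c i)
    (hc : ∀ T : Finset ι, ∑ i ∈ T, c i ≤ capacity D T.card) :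
    ∃ S : Schedule ι n', Feasible S ∧ ∀ i, scheduleClicks D S i = c i := by
  classical
  let N := n' + Fintype.card ι
  let v : (ι ↪ Fin N) → ι → ℝ := fun g i => padded D (g i)
  -- Otherwise a linear functional with coefficients `w` separates `c` from all assignments. The
  -- greedy assignment, sorted by weight, contradicts this.
  have hmem : c ∈ convexHull ℝ (Set.range v) := by
    by_contra hnot
    obtain ⟨f, u, hf, hu⟩ := geometric_hahn_banach_closed_point (convex_convexHull ℝ _)
      ((Set.finite_range v).isClosed_convexHull ℝ) hnot
    have hfs : ∀ x : ι → ℝ, f x = ∑ i, x i * f (Pi.single i 1) := fun x => by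
      have := LinearMap.pi_apply_eq_sum_univ (f : (ι → ℝ) →ₗ[ℝ] ℝ) x
      simp only [ContinuousLinearMap.coe_coe, smul_eq_mul] at this
      rw [this]
      refine Finset.sum_congr rfl fun i _ => ?_
      congr 2
      funext j
      simp [Pi.single_apply, eq_comm]
    let w : ι → ℝ := fun i => f (Pi.single i 1)
    let w' : ι → ℝ := fun i => max (w i) 0
    let ρ := rank w' Finset.univ
    have hρ : ∀ i, ρ i < Fintype.card ι := fun i => rank_lt_card (Finset.mem_univ i)
    have hρinj : ∀ i j, ρ i = ρ j → i = j := fun i j h =>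
      rank_injOn w' Finset.univ (Finset.mem_coe.2 (Finset.mem_univ i))
        (Finset.mem_coe.2 (Finset.mem_univ j)) h
    have hρlt : ∀ i j, 0 < w i → ¬ 0 < w j → ρ i < ρ j := fun i j hi hj => by
      apply rank_lt_rank_of_mem (Finset.mem_univ i)
      left
      simp only [w', max_eq_right (not_lt.1 hj)]
      exact lt_max_of_lt_left hi
    -- Positive weights occupy the first slots in decreasing order; bidders of nonpositive weight go
    -- to dummy slots. Replacing `w` by its positive part `w'` changes nothing for this assignment
    -- and can only increase the value at `c ≥ 0`.
    let γ : ι → ℕ := fun i => if 0 < w i then ρ i else n' + ρ i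
    have hγ : ∀ i, γ i < N := fun i => by
      have := hρ i
      simp only [γ, N]
      split_ifs <;> omega
    have hγinj : Function.Injective γ := by
      intro i j h
      have hij := hρlt i j
      have hji := hρlt j i
      apply hρinj
      by_cases hi : 0 < w i <;> by_cases hj : 0 < w j <;>
        simp only [γ, hi, hj, if_true, if_false, true_implies, not_true, not_false_iff,
          false_implies] at h hij hji <;> omega
    let g : ι ↪ Fin N := ⟨fun i => ⟨γ i, hγ i⟩, fun i j h => hγinj (Fin.mk.inj h)⟩
    have hgv : ∀ i, v g i * w i = padded D (ρ i) * w' i := by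
      intro i
      change padded D (γ i) * w i = _
      by_cases hi : 0 < w i
      · simp only [γ, w', hi, if_true, max_eq_left hi.le]
      · simp only [γ, w', hi, if_false, max_eq_right (not_lt.1 hi), mul_zero]
        rw [padded_of_le (by omega), zero_mul]
    have h1 := hf (v g) (subset_convexHull ℝ _ ⟨g, rfl⟩)
    rw [hfs] at h1 hu
    have h2 : ∑ i, c i * w i ≤ ∑ i, v g i * w i := by
      have key := sum_mul_nonneg_of_top Finset.univ w' (fun i => padded D (ρ i) - c i) (by
        intro l hl
        rw [Finset.sum_sub_distrib, sum_rank_top w' hl]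
        have := hc (top w' Finset.univ l)
        rw [card_top w' hl, capacity] at this
        linarith) _ le_rfl 0 (fun i _ => le_max_right _ _)
      rw [top_of_card_le w' le_rfl] at key
      calc ∑ i, c i * w i ≤ ∑ i, c i * w' i :=
            Finset.sum_le_sum fun i _ => mul_le_mul_of_nonneg_left (le_max_left _ _) (hc0 i)
        _ ≤ ∑ i, padded D (ρ i) * w' i := by
            rw [← sub_nonneg, ← Finset.sum_sub_distrib]
            convert key using 2
            ring
        _ = _ := Finset.sum_congr rfl fun i _ => (hgv i).symm
    simp only [w] at h2
    linarith
  obtain ⟨κ, _, w, z, hw, hw1, hz, hsum⟩ := mem_convexHull_iff_exists_fintype.1 hmem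
  choose G hG using hz
  obtain ⟨S, hS, hSc⟩ := exists_schedule_of_convex (D := D) w hw hw1 (fun k i => G k i)
    (fun k i j h => (G k).injective (Fin.ext h))
  refine ⟨S, hS, fun i => ?_⟩
  rw [hSc, ← hsum, Finset.sum_apply]
  exact Finset.sum_congr rfl fun k _ => by rw [← hG]; simp [v]

end Scheduling

/-! ### Uncrossing tight sets. -/

section TightSets

variable {ι : Type*} {n' : ℕ} {D : Fin n' → ℝ} {c : ι → ℝ}

/-- Submodularity forces equality in the constraints of both the union and the intersection. -/
theorem tight_union [DecidableEq ι] (hD : StrictAnti D) (hD0 : ∀ j, 0 ≤ D j)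
    (hc : ∀ T : Finset ι, ∑ i ∈ T, c i ≤ capacity D T.card) {X Y : Finset ι}
    (hX : ∑ i ∈ X, c i = capacity D X.card) (hY : ∑ i ∈ Y, c i = capacity D Y.card) :
    ∑ i ∈ X ∪ Y, c i = capacity D (X ∪ Y).card := by
  have h1 := capacity_submodular hD hD0 0 X Y
  simp only [zero_add] at h1
  have h2 := Finset.sum_union_inter (s₁ := X) (s₂ := Y) (f := c)
  have h3 := hc (X ∩ Y)
  have h4 := hc (X ∪ Y)
  linarith

theorem exists_largest_tight (hD : StrictAnti D) (hD0 : ∀ j, 0 ≤ D j)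
    (hc : ∀ T : Finset ι, ∑ i ∈ T, c i ≤ capacity D T.card) (Q : Finset ι) :
    ∃ Z ⊆ Q, ∑ i ∈ Z, c i = capacity D Z.card ∧
      ∀ Y ⊆ Q, ∑ i ∈ Y, c i = capacity D Y.card → Y ⊆ Z := by
  classical
  obtain ⟨Z, hZ, hmax⟩ := Finset.exists_max_image
    (Q.powerset.filter fun Z => ∑ i ∈ Z, c i = capacity D Z.card) Finset.card
    ⟨∅, by simp [capacity_zero]⟩
  simp only [Finset.mem_filter, Finset.mem_powerset] at hZ hmax
  refine ⟨Z, hZ.1, hZ.2, fun Y hYQ hY => ?_⟩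
  have h := hmax (Z ∪ Y) ⟨Finset.union_subset hZ.1 hYQ, tight_union hD hD0 hc hZ.2 hY⟩
  rw [Finset.eq_of_subset_of_card_le Finset.subset_union_left h]
  exact Finset.subset_union_right

end TightSets

/-! ### The greedy mechanism through its tight sets. -/

section Greedy

variable {ι : Type*} [LinearOrder ι] [Fintype ι] {n' : ℕ} {D : Fin n' → ℝ} {b B : ι → ℝ}

/-- Replaces schedules by polymatroid constraints in the recursive definition. By induction on the
rank, the clicks of the earlier bidders satisfy these constraints, so 0 is admissible; the
admissible set is closed and bounded, and its supremum is attained. -/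
theorem gfpClicks_spec (hD : StrictAnti D) (hD0 : ∀ j, 0 ≤ D j) (hB : ∀ i, 0 ≤ B i) (i : ι) :
    (0 ≤ gfpClicks D b B i ∧ b i * gfpClicks D b B i ≤ B i ∧
      ∀ T : Finset ι, (∀ j ∈ T, Precedes b j i) →
        ∑ j ∈ T, gfpClicks D b B j + gfpClicks D b B i ≤ capacity D (T.card + 1)) ∧
    ∀ y, 0 ≤ y → b i * y ≤ B i →
      (∀ T : Finset ι, (∀ j ∈ T, Precedes b j i) →
        ∑ j ∈ T, gfpClicks D b B j + y ≤ capacity D (T.card + 1)) →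
      y ≤ gfpClicks D b B i := by
  classical
  induction hr : rank b Finset.univ i using Nat.strong_induction_on generalizing i with
  | _ r ih =>
  subst hr
  have ih' : ∀ j, Precedes b j i → 0 ≤ gfpClicks D b B j ∧
      ∀ T : Finset ι, (∀ k ∈ T, Precedes b k j) →
        ∑ k ∈ T, gfpClicks D b B k + gfpClicks D b B j ≤ capacity D (T.card + 1) :=
    fun j hj => have h := (ih _ (rank_lt_rank hj) j rfl).1; ⟨h.1, h.2.2⟩
  have hprev : ∀ T : Finset ι, (∀ j ∈ T, Precedes b j i) →
      ∑ j ∈ T, gfpClicks D b B j ≤ capacity D T.card := by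
    intro T hT
    rcases T.eq_empty_or_nonempty with rfl | hne
    · simp [capacity_zero]
    obtain ⟨k, hk, hmax⟩ := Finset.exists_max_image T (rank b Finset.univ) hne
    have h := (ih' k (hT k hk)).2 (T.erase k) (fun j hj => by
      rw [Finset.mem_erase] at hj
      refine (Precedes.total b hj.1).resolve_right fun h => ?_
      have := rank_lt_rank h
      have := hmax j hj.2
      omega)
    rw [Finset.sum_erase_add _ _ hk, Finset.card_erase_add_one hk] at h
    exact h
  have hset : {x : ℝ | b i * x ≤ B i ∧ ∃ S : Schedule ι n', Feasible S ∧
      scheduleClicks D S i = x ∧ ∀ j, Precedes b j i → scheduleClicks D S j = gfpClicks D b B j} =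
      {x : ℝ | 0 ≤ x ∧ b i * x ≤ B i ∧ ∀ T : Finset ι, (∀ j ∈ T, Precedes b j i) →
        ∑ j ∈ T, gfpClicks D b B j + x ≤ capacity D (T.card + 1)} := by
    ext x
    constructor
    · rintro ⟨hx, S, hS, rfl, hprec⟩
      refine ⟨scheduleClicks_nonneg hD0 hS i, hx, fun T hT => ?_⟩
      have hi : i ∉ T := fun h => Precedes.irrefl b i (hT i h)
      have h := hS.sum_le hD hD0 (insert i T)
      rw [Finset.sum_insert hi, Finset.card_insert_of_notMem hi,
        Finset.sum_congr rfl fun j hj => hprec j (hT j hj)] at h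
      linarith
    · rintro ⟨hx0, hx, hxT⟩
      refine ⟨hx, ?_⟩
      -- Later bidders receive zero clicks, so only constraints on earlier bidders and `i` matter.
      obtain ⟨S, hS, hSc⟩ := exists_schedule (D := D)
        (fun j => if j = i then x else if Precedes b j i then gfpClicks D b B j else 0)
        (fun j => by
          split_ifs with h1 h2
          · exact hx0
          · exact (ih' j h2).1
          · exact le_rfl)
        (fun T => by
          have e : ∀ T : Finset ι, i ∉ T → ∑ j ∈ T, (if j = i then x else
              if Precedes b j i then gfpClicks D b B j else 0) =
              ∑ j ∈ T with Precedes b j i, gfpClicks D b B j := by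
            intro T hi
            rw [Finset.sum_filter]
            refine Finset.sum_congr rfl fun j hj => ?_
            rw [if_neg]
            rintro rfl
            exact hi hj
          by_cases hi : i ∈ T
          · rw [← Finset.sum_erase_add _ _ hi, e _ (Finset.notMem_erase i T), if_pos rfl]
            refine (hxT _ fun j hj => (Finset.mem_filter.1 hj).2).trans
              (capacity_mono hD0 ?_)
            rw [← Finset.card_erase_add_one hi]
            exact Nat.succ_le_succ (Finset.card_filter_le _ _)
          · rw [e T hi]
            exact (hprev _ fun j hj => (Finset.mem_filter.1 hj).2).trans
              (capacity_mono hD0 (Finset.card_filter_le _ _)))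
      refine ⟨S, hS, by rw [hSc, if_pos rfl], fun j hj => ?_⟩
      have : j ≠ i := by rintro rfl; exact Precedes.irrefl b j hj
      rw [hSc, if_neg this, if_pos hj]
  have heq : gfpClicks D b B i = sSup {x : ℝ | 0 ≤ x ∧ b i * x ≤ B i ∧
      ∀ T : Finset ι, (∀ j ∈ T, Precedes b j i) →
        ∑ j ∈ T, gfpClicks D b B j + x ≤ capacity D (T.card + 1)} := by
    rw [gfpClicks, hset]
  have hbdd : BddAbove {x : ℝ | 0 ≤ x ∧ b i * x ≤ B i ∧
      ∀ T : Finset ι, (∀ j ∈ T, Precedes b j i) →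
        ∑ j ∈ T, gfpClicks D b B j + x ≤ capacity D (T.card + 1)} :=
    ⟨capacity D 1, fun x hx => by simpa using hx.2.2 ∅ (by simp)⟩
  refine ⟨?_, fun y h0 h1 h2 => ?_⟩
  · have hclosed : IsClosed {x : ℝ | 0 ≤ x ∧ b i * x ≤ B i ∧
        ∀ T : Finset ι, (∀ j ∈ T, Precedes b j i) →
          ∑ j ∈ T, gfpClicks D b B j + x ≤ capacity D (T.card + 1)} := by
      simp only [Set.ofPred_and, Set.ofPred_forall]
      refine (isClosed_le (by fun_prop) (by fun_prop)).inter
        ((isClosed_le (by fun_prop) (by fun_prop)).inter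
          (isClosed_iInter fun T => isClosed_iInter fun _ =>
            isClosed_le (by fun_prop) (by fun_prop)))
    have := hclosed.csSup_mem ⟨0, le_rfl, by simpa using hB i, fun T hT => by
      have := hprev T hT
      have := capacity_mono hD0 (Nat.le_succ T.card)
      simp only [Nat.succ_eq_add_one] at this
      linarith⟩ hbdd
    rw [← heq] at this
    exact this
  · rw [heq]
    exact le_csSup hbdd ⟨h0, h1, h2⟩

theorem gfpClicks_nonneg (hD : StrictAnti D) (hD0 : ∀ j, 0 ≤ D j) (hB : ∀ i, 0 ≤ B i) (i : ι) :
    0 ≤ gfpClicks D b B i :=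
  (gfpClicks_spec hD hD0 hB i).1.1

theorem mul_gfpClicks_le (hD : StrictAnti D) (hD0 : ∀ j, 0 ≤ D j) (hB : ∀ i, 0 ≤ B i) (i : ι) :
    b i * gfpClicks D b B i ≤ B i :=
  (gfpClicks_spec hD hD0 hB i).1.2.1

theorem sum_gfpClicks_le (hD : StrictAnti D) (hD0 : ∀ j, 0 ≤ D j) (hB : ∀ i, 0 ≤ B i)
    (T : Finset ι) : ∑ j ∈ T, gfpClicks D b B j ≤ capacity D T.card := by
  classical
  rcases T.eq_empty_or_nonempty with rfl | hne
  · simp [capacity_zero]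
  obtain ⟨k, hk, hmax⟩ := Finset.exists_max_image T (rank b Finset.univ) hne
  have h := (gfpClicks_spec (b := b) hD hD0 hB k).1.2.2 (T.erase k) (fun j hj => by
    rw [Finset.mem_erase] at hj
    refine (Precedes.total b hj.1).resolve_right fun h => ?_
    have := rank_lt_rank h
    have := hmax j hj.2
    omega)
  rwa [Finset.sum_erase_add _ _ hk, Finset.card_erase_add_one hk] at h

/-- A bidder in the greedy mechanism exhausts her budget or is blocked by a tight set of bidders. -/
theorem gfpClicks_saturated_or_tight (hD : StrictAnti D) (hD0 : ∀ j, 0 ≤ D j) (hB : ∀ i, 0 ≤ B i)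
    (i : ι) : B i ≤ b i * gfpClicks D b B i ∨
      ∃ Z : Finset ι, i ∈ Z ∧ (∀ j ∈ Z, j = i ∨ Precedes b j i) ∧
        ∑ j ∈ Z, gfpClicks D b B j = capacity D Z.card := by
  classical
  by_contra! hcon
  obtain ⟨h1, h2⟩ := hcon
  have hstrict : ∀ T : Finset ι, (∀ j ∈ T, Precedes b j i) →
      ∑ j ∈ T, gfpClicks D b B j + gfpClicks D b B i < capacity D (T.card + 1) := by
    intro T hT
    have hi : i ∉ T := fun h => Precedes.irrefl b i (hT i h)
    have h3 := h2 (insert i T) (Finset.mem_insert_self _ _)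
      (fun j hj => (Finset.mem_insert.1 hj).imp id (hT j))
    have h4 := sum_gfpClicks_le (b := b) hD hD0 hB (insert i T)
    rw [Finset.sum_insert hi, Finset.card_insert_of_notMem hi] at h3 h4
    rw [add_comm]
    exact lt_of_le_of_ne h4 h3
  -- With no binding constraint among finitely many, slightly more clicks would still be admissible,
  -- against maximality.
  have hev : ∀ᶠ y in nhdsWithin (gfpClicks D b B i) (Set.Ioi (gfpClicks D b B i)),
      b i * y < B i ∧ ∀ T : Finset ι, (∀ j ∈ T, Precedes b j i) →
        ∑ j ∈ T, gfpClicks D b B j + y < capacity D (T.card + 1) := by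
    apply nhdsWithin_le_nhds
    refine Filter.Eventually.and ?_ (Filter.eventually_all.2 fun T => ?_)
    · exact ContinuousAt.eventually_lt (by fun_prop) (by fun_prop) h1
    · by_cases hT : ∀ j ∈ T, Precedes b j i
      · filter_upwards [ContinuousAt.eventually_lt
          (f := fun y => ∑ j ∈ T, gfpClicks D b B j + y) (g := fun _ => capacity D (T.card + 1))
          (by fun_prop) (by fun_prop) (hstrict T hT)] with y hy _
        exact hy
      · exact Filter.Eventually.of_forall fun y h => absurd h hT
  obtain ⟨y, ⟨hy1, hy2⟩, hy⟩ := (hev.and self_mem_nhdsWithin).exists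
  have hy' : gfpClicks D b B i < y := hy
  have := (gfpClicks_spec (b := b) hD hD0 hB i).2 y
    ((gfpClicks_nonneg hD hD0 hB i).trans hy'.le) hy1.le fun T hT => (hy2 T hT).le
  linarith

/-- If a reference vector `c` of clicks is tight on a set `X` of bidders, all of which bid before
`i`, and those who exhaust their budgets receive nearly their reference clicks, then `i` receives
hardly more than her reference clicks. -/
theorem gfpClicks_le_of_tight (hD : StrictAnti D) (hD0 : ∀ j, 0 ≤ D j) (hB : ∀ i, 0 ≤ B i)
    {c : ι → ℝ} (hc : ∀ T : Finset ι, ∑ j ∈ T, c j ≤ capacity D T.card) {X : Finset ι} {i : ι}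
    (hi : i ∈ X) (hX : ∑ j ∈ X, c j = capacity D X.card) {η : ℝ} (hη : 0 ≤ η)
    (hprec : ∀ j ∈ X, j ≠ i → Precedes b j i)
    (hsat : ∀ j ∈ X, j ≠ i → B j ≤ b j * gfpClicks D b B j → c j - η ≤ gfpClicks D b B j) :
    gfpClicks D b B i ≤ c i + Fintype.card ι * η := by
  classical
  -- `Z` is the largest tight set among the bidders before `i`. A member of `X` outside `Z`, other
  -- than `i`, cannot be blocked: her blocking set would consist of bidders before `i` and so lie in
  -- `Z`. Hence she exhausts her budget.
  obtain ⟨Z, hZQ, hZ, hmax⟩ := exists_largest_tight hD hD0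
    (sum_gfpClicks_le (b := b) hD hD0 hB) (Finset.univ.filter fun j => Precedes b j i)
  have hiZ : i ∉ Z := fun h => Precedes.irrefl b i (Finset.mem_filter.1 (hZQ h)).2
  have hlow : ∀ j ∈ (X \ Z).erase i, c j - η ≤ gfpClicks D b B j := by
    intro j hj
    rw [Finset.mem_erase, Finset.mem_sdiff] at hj
    rcases gfpClicks_saturated_or_tight (b := b) hD hD0 hB j with h | ⟨Y, hjY, hY, hYt⟩
    · exact hsat j hj.2.1 hj.1 h
    · refine absurd (hmax Y (fun k hk => ?_) hYt hjY) hj.2.2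
      have hji := hprec j hj.2.1 hj.1
      rcases hY k hk with rfl | h
      · simpa using hji
      · simpa using h.trans hji
  have hiXZ : i ∈ X \ Z := Finset.mem_sdiff.2 ⟨hi, hiZ⟩
  have h1 : ∑ j ∈ (X \ Z).erase i, c j - Fintype.card ι * η ≤
      ∑ j ∈ (X \ Z).erase i, gfpClicks D b B j := by
    have h := Finset.sum_le_sum hlow
    rw [Finset.sum_sub_distrib, Finset.sum_const, nsmul_eq_mul] at h
    have h' : (((X \ Z).erase i).card : ℝ) * η ≤ Fintype.card ι * η :=
      mul_le_mul_of_nonneg_right (by exact_mod_cast Finset.card_le_univ _) hη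
    linarith
  have h2 := Finset.sum_erase_add (X \ Z) c hiXZ
  have h3 := Finset.sum_erase_add (X \ Z) (gfpClicks D b B) hiXZ
  -- Writing `g` for the greedy clicks and `C` for the capacity as a set function: `g(X \ Z) ≤ C(X ∪
  -- Z) - C(Z) ≤ C(X) - C(X ∩ Z) ≤ c(X \ Z)`. Cancelling the near-equalities for the bidders other
  -- than `i` bounds `g i`.
  have h4 := Finset.sum_inter_add_sum_sdiff X Z c
  have h5 := hc (X ∩ Z)
  have h6 := capacity_submodular hD hD0 0 X Z
  simp only [zero_add] at h6
  have h7 := sum_gfpClicks_le (b := b) hD hD0 hB (X ∪ Z)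
  rw [← Finset.sdiff_union_self_eq_union, Finset.sum_union Finset.sdiff_disjoint] at h7
  rw [Finset.sdiff_union_self_eq_union] at h7
  linarith

end Greedy

/-! ### Find-Price-Block as a family of inequalities over all subsets. -/

section FindPriceBlock

variable {ι : Type*} [LinearOrder ι] {n' : ℕ} {D : Fin n' → ℝ} {B : ι → ℝ} {A : Finset ι} {s : ℕ}

theorem capacity_sub_pos (hD0 : ∀ j, 0 ≤ D j) (hs : 0 < padded D s) {l : ℕ} (hl : 1 ≤ l) :
    0 < capacity D (s + l) - capacity D s := by
  have h1 := capacity_mono hD0 (show s + 1 ≤ s + l by omega)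
  rw [capacity_succ] at h1
  linarith

theorem ratio_eq (l : ℕ) :
    ratio D B A s l = (∑ i ∈ top B A l, B i) / (capacity D (s + l) - capacity D s) := by
  rw [ratio, capacity_add, add_sub_cancel_left]

theorem ratio_le_blockPrice {l : ℕ} (h1 : 1 ≤ l) (hl : l ≤ A.card) :
    ratio D B A s l ≤ blockPrice D B A s :=
  le_csSup ((Set.finite_Icc 1 A.card).image _).bddAbove ⟨l, ⟨h1, hl⟩, rfl⟩

/-- The ratios only see the sets of largest budgets, but these dominate all sets of the same size.
The resulting form, free of sorting, can be combined with submodularity. -/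
theorem sum_le_blockPrice (hD0 : ∀ j, 0 ≤ D j) (hs : 0 < padded D s) {T : Finset ι} (hT : T ⊆ A) :
    ∑ i ∈ T, B i ≤ blockPrice D B A s * (capacity D (s + T.card) - capacity D s) := by
  rcases T.eq_empty_or_nonempty with rfl | hne
  · simp
  have h := ratio_le_blockPrice (D := D) (B := B) (s := s) hne.card_pos (Finset.card_le_card hT)
  rw [ratio_eq, div_le_iff₀ (capacity_sub_pos hD0 hs hne.card_pos)] at h
  exact (sum_le_sum_top B hT).trans h

theorem blockLength_spec (hA : A.Nonempty) :
    (1 ≤ blockLength D B A s ∧ ratio D B A s (blockLength D B A s) = blockPrice D B A s) ∧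
      blockLength D B A s ≤ A.card := by
  classical
  refine ⟨?_, Nat.findGreatest_le _⟩
  have hmem := ((Set.nonempty_Icc.2 hA.card_pos).image (ratio D B A s)).csSup_mem
    ((Set.finite_Icc 1 A.card).image (ratio D B A s))
  obtain ⟨l, ⟨h1, hl⟩, he⟩ := hmem
  exact Nat.findGreatest_spec (P := fun l => 1 ≤ l ∧ ratio D B A s l = blockPrice D B A s) hl
    ⟨h1, he⟩

theorem sum_top_blockLength (hD0 : ∀ j, 0 ≤ D j) (hs : 0 < padded D s) (hA : A.Nonempty) :
    ∑ i ∈ top B A (blockLength D B A s), B i = blockPrice D B A s *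
      (capacity D (s + blockLength D B A s) - capacity D s) := by
  obtain ⟨⟨h1, h2⟩, -⟩ := blockLength_spec (D := D) (B := B) (s := s) hA
  rw [← h2, ratio_eq, div_mul_cancel₀ _ (capacity_sub_pos hD0 hs h1).ne']

/-- Strict because the block is the longest one attaining the maximal ratio. -/
theorem sum_lt_blockPrice (hD0 : ∀ j, 0 ≤ D j) (hs : 0 < padded D s) {T : Finset ι} (hT : T ⊆ A)
    (hlt : blockLength D B A s < T.card) :
    ∑ i ∈ T, B i < blockPrice D B A s * (capacity D (s + T.card) - capacity D s) := by
  classical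
  have h1 : 1 ≤ T.card := by omega
  have hle := Finset.card_le_card hT
  have hlt' : ratio D B A s T.card < blockPrice D B A s := by
    refine lt_of_le_of_ne (ratio_le_blockPrice h1 hle) fun he => ?_
    exact Nat.findGreatest_is_greatest
      (P := fun l => 1 ≤ l ∧ ratio D B A s l = blockPrice D B A s) hlt hle ⟨h1, he⟩
  rw [ratio_eq, div_lt_iff₀ (capacity_sub_pos hD0 hs h1)] at hlt'
  exact (sum_le_sum_top B hT).trans_lt hlt'

theorem blockPrice_le (hD0 : ∀ j, 0 ≤ D j) (hs : 0 < padded D s) (hA : A.Nonempty) {q : ℝ}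
    (h : ∀ T ⊆ A, ∑ i ∈ T, B i ≤ q * (capacity D (s + T.card) - capacity D s)) :
    blockPrice D B A s ≤ q := by
  obtain ⟨⟨h1, h2⟩, h3⟩ := blockLength_spec (D := D) (B := B) (s := s) hA
  rw [← h2, ratio_eq, div_le_iff₀ (capacity_sub_pos hD0 hs h1)]
  have := h _ (top_subset B A (blockLength D B A s))
  rwa [card_top B h3] at this

end FindPriceBlock

/-! ### One round of the price-setting mechanism. -/

section Round

variable {ι : Type*} [LinearOrder ι] {n' : ℕ}

/-- The properties of a price block `P` with price `p` that is formed by Find-Price-Block on the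
bidders `A`, with budgets `B'`, when the bidders `R` and the slots from `s` on remain; the last
bidder of `A` is `k`. -/
structure IsPriceBlock (D : Fin n' → ℝ) (m B : ι → ℝ) (R : Finset ι) (s : ℕ) (A P : Finset ι)
    (B' : ι → ℝ) (p : ℝ) (k : ι) : Prop where
  subset : A ⊆ R
  last_mem : k ∈ A
  mem_iff : ∀ j ∈ R, j ∈ A ↔ j = k ∨ Precedes m j k
  price_pos : 0 < p
  price_le : p ≤ m k
  budget_nonneg : ∀ i ∈ A, 0 ≤ B' i
  budget_le : ∀ i ∈ A, B' i ≤ B i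
  budget_eq : ∀ i ∈ A, i ≠ k → B' i = B i
  reduced : B' k = B k ∨ (p = m k ∧ k ∈ P)
  out_le : ∀ i ∈ R, i ∉ A → m i ≤ p
  out_exists : ∀ i ∈ R, i ∉ A → ∃ T ⊆ A, T.Nonempty ∧
    m i * (capacity D (s + T.card) - capacity D s) ≤ ∑ j ∈ T, B j
  block_subset : P ⊆ A
  block_nonempty : P.Nonempty
  block_sum : ∑ i ∈ P, B' i = p * (capacity D (s + P.card) - capacity D s)
  sum_le : ∀ T ⊆ A, ∑ i ∈ T, B' i ≤ p * (capacity D (s + T.card) - capacity D s)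
  sum_lt : ∀ T ⊆ A, P.card < T.card →
    ∑ i ∈ T, B' i < p * (capacity D (s + T.card) - capacity D s)

variable {D : Fin n' → ℝ} {m B : ι → ℝ} {R : Finset ι} {s : ℕ}

theorem stopIndex_spec (hR : R.Nonempty) :
    (1 ≤ stopIndex D m B R s ∧ ∀ i ∈ R, rank m R i = stopIndex D m B R s →
      m i ≤ blockPrice D B (top m R (stopIndex D m B R s)) s) ∧ stopIndex D m B R s ≤ R.card := by
  have h : R.card ∈ {k : ℕ | 1 ≤ k ∧ ∀ i ∈ R, rank m R i = k →
      m i ≤ blockPrice D B (top m R k) s} :=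
    ⟨hR.card_pos, fun i hi he => absurd (rank_lt_card (v := m) hi) (by omega)⟩
  exact ⟨Nat.sInf_mem ⟨_, h⟩, Nat.sInf_le h⟩

theorem blockPrice_lt_of_lt_stopIndex {k : ι} (hk : k ∈ R) (h1 : 1 ≤ rank m R k)
    (hlt : rank m R k < stopIndex D m B R s) :
    blockPrice D B (top m R (rank m R k)) s < m k := by
  have h := Nat.notMem_of_lt_sInf hlt
  simp only [Set.mem_ofPred_eq, not_and, not_forall, not_le] at h
  obtain ⟨i, hi, he, hlt⟩ := h h1
  rwa [rank_injOn m R hi hk he] at hlt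

theorem sum_update_of_mem' {T : Finset ι} {k : ι} (hk : k ∈ T) (x : ℝ) :
    ∑ i ∈ T, Function.update B k x i = ∑ i ∈ T.erase k, B i + x := by
  rw [← Finset.sum_erase_add _ _ hk, Function.update_self]
  congr 1
  exact Finset.sum_congr rfl fun i hi => Function.update_of_ne (Finset.ne_of_mem_erase hi) _ _

/-- The delicate point is the last bidder `k`: if her budget is really reduced, the price is exactly
`m k` and she belongs to the block. So a reduced budget never survives into a later round. The
stopping rule concerns the original budgets `B`, whence their appearance in `out_exists`. -/
theorem isPriceBlock_psRound (hD : StrictAnti D) (hD0 : ∀ j, 0 ≤ D j) (hm : ∀ i, 0 < m i)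
    (hB : ∀ i, 0 < B i) (hR : R.Nonempty) (hs : 0 < padded D s) :
    ∃ k, IsPriceBlock D m B R s (top m R (stopIndex D m B R s))
      (top (reducedBudget D m B R s) (top m R (stopIndex D m B R s))
        (blockLength D (reducedBudget D m B R s) (top m R (stopIndex D m B R s)) s))
      (reducedBudget D m B R s)
      (blockPrice D (reducedBudget D m B R s) (top m R (stopIndex D m B R s)) s) k := by
  classical
  obtain ⟨⟨h1, hstopIdx⟩, hle⟩ := stopIndex_spec (D := D) (m := m) (B := B) (s := s) hR
  obtain ⟨k, hkR, hrk⟩ := exists_rank_eq (A := R) m (l := stopIndex D m B R s - 1) (by omega)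
  have hk0 : stopIndex D m B R s = rank m R k + 1 := by omega
  set A := top m R (stopIndex D m B R s) with hA
  set B' := reducedBudget D m B R s with hB'
  set p := blockPrice D B' A s with hp
  set l := blockLength D B' A s with hl
  set P := top B' A l with hP
  have hAR : A ⊆ R := top_subset _ _ _
  have hmem : ∀ j ∈ R, j ∈ A ↔ j = k ∨ Precedes m j k := fun j hj => by
    rw [hA, hk0, mem_top_succ_iff hkR hj]
  have hkA : k ∈ A := (hmem k hkR).2 (Or.inl rfl)
  have hAne : A.Nonempty := ⟨k, hkA⟩
  have hG : ∀ {t : ℕ}, 1 ≤ t → 0 < capacity D (s + t) - capacity D s :=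
    fun ht => capacity_sub_pos hD0 hs ht
  obtain ⟨⟨hl1, -⟩, hlA⟩ := blockLength_spec (D := D) (B := B') (s := s) hAne
  have hPcard : P.card = l := card_top B' hlA
  have hPA : P ⊆ A := top_subset _ _ _
  have hPsum : ∑ i ∈ P, B' i = p * (capacity D (s + P.card) - capacity D s) := by
    rw [hPcard]; exact sum_top_blockLength hD0 hs hAne
  have hsum_le : ∀ T ⊆ A, ∑ i ∈ T, B' i ≤ p * (capacity D (s + T.card) - capacity D s) :=
    fun T hT => sum_le_blockPrice hD0 hs hT
  have hsum_lt : ∀ T ⊆ A, P.card < T.card →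
      ∑ i ∈ T, B' i < p * (capacity D (s + T.card) - capacity D s) :=
    fun T hT hlt => sum_lt_blockPrice hD0 hs hT (by rwa [hPcard] at hlt)
  have hout : ∀ i ∈ R, i ∉ A → m i ≤ blockPrice D B A s := by
    intro i hi hiA
    have hri : stopIndex D m B R s ≤ rank m R i := by
      by_contra h
      exact hiA (mem_top.2 ⟨hi, not_le.1 h⟩)
    obtain ⟨i₁, hi₁, hr₁⟩ := exists_rank_eq (A := R) m (hri.trans_lt (rank_lt_card hi))
    refine le_trans ?_ (hstopIdx i₁ hi₁ hr₁)
    rcases hri.eq_or_lt with he | hlt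
    · rw [rank_injOn m R hi hi₁ (he.symm.trans hr₁.symm)]
    · rw [← hr₁, rank_lt_rank_iff hi hi₁] at hlt
      exact hlt.le
  -- Minimality of the stopping index: the bidders before `k` alone give a price below `m k`. In
  -- particular, reducing the budget of `k` to 0 is always enough.
  have hpre : ∀ T ⊆ A, k ∉ T → T.Nonempty →
      ∑ i ∈ T, B i < m k * (capacity D (s + T.card) - capacity D s) := by
    intro T hT hkT hne
    have hTsub : T ⊆ top m R (rank m R k) := by
      intro j hj
      have hjR := hAR (hT hj)
      have hjk : j ≠ k := by rintro rfl; exact hkT hj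
      exact mem_top.2 ⟨hjR, (rank_lt_rank_iff hkR hjR).2
        (((hmem j hjR).1 (hT hj)).resolve_left hjk)⟩
    have hpos : 1 ≤ rank m R k := by
      obtain ⟨j, hj⟩ := hne
      have := (mem_top.1 (hTsub hj)).2
      omega
    have h := blockPrice_lt_of_lt_stopIndex (D := D) (B := B) (s := s) hkR hpos (by omega)
    exact (sum_le_blockPrice hD0 hs hTsub).trans_lt
      (mul_lt_mul_of_pos_right h (hG hne.card_pos))
  have hpre' : ∀ T ⊆ A, k ∉ T →
      ∑ i ∈ T, B i ≤ m k * (capacity D (s + T.card) - capacity D s) := by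
    intro T hT hkT
    rcases T.eq_empty_or_nonempty with rfl | hne
    · simp
    · exact (hpre T hT hkT hne).le
  let W : Set ℝ := {x | 0 ≤ x ∧ x ≤ B k ∧ ∀ T ⊆ A,
    ∑ i ∈ T, Function.update B k x i ≤ m k * (capacity D (s + T.card) - capacity D s)}
  have hcont : ∀ T : Finset ι, Continuous fun x => ∑ i ∈ T, Function.update B k x i := fun T =>
    continuous_finsetSum _ fun i _ =>
      (continuous_apply i).comp ((continuous_const (y := B)).update k continuous_id)
  have hBk : B' k = sSup W := by
    rw [hB', reducedBudget, if_pos hk0.symm]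
    congr 1
    ext x
    refine and_congr_right fun _ => and_congr_right fun _ => ⟨fun h T hT => ?_, fun h => ?_⟩
    · exact (sum_le_blockPrice hD0 hs hT).trans (mul_le_mul_of_nonneg_right h
        (sub_nonneg.2 (capacity_mono hD0 (Nat.le_add_right _ _))))
    · exact blockPrice_le hD0 hs hAne h
  have hWbdd : BddAbove W := ⟨B k, fun x hx => hx.2.1⟩
  have h0W : (0 : ℝ) ∈ W := by
    refine ⟨le_rfl, (hB k).le, fun T hT => ?_⟩
    by_cases hkT : k ∈ T
    · rw [sum_update_of_mem' hkT, add_zero]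
      refine (hpre' _ ((Finset.erase_subset _ _).trans hT) (Finset.notMem_erase _ _)).trans ?_
      have := capacity_mono hD0 (show s + (T.erase k).card ≤ s + T.card from
        Nat.add_le_add_left (Finset.card_le_card (Finset.erase_subset _ _)) _)
      exact mul_le_mul_of_nonneg_left (by linarith) (hm k).le
    · rw [Finset.sum_update_of_notMem hkT]
      exact hpre' T hT hkT
  have hWclosed : IsClosed W := by
    simp only [W, Set.ofPred_and, Set.ofPred_forall]
    exact (isClosed_le continuous_const continuous_id).inter
      ((isClosed_le continuous_id continuous_const).inter
        (isClosed_iInter fun T => isClosed_iInter fun _ =>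
          isClosed_le (hcont T) continuous_const))
  have hxW : B' k ∈ W := hBk ▸ hWclosed.csSup_mem ⟨0, h0W⟩ hWbdd
  have hBeq : ∀ i ∈ A, i ≠ k → B' i = B i := by
    intro i hi hik
    rw [hB', reducedBudget, if_neg]
    intro h
    exact hik (rank_injOn m R (hAR hi) hkR (by omega))
  have hupd : ∀ T ⊆ A, ∑ i ∈ T, Function.update B k (B' k) i = ∑ i ∈ T, B' i := by
    intro T hT
    refine Finset.sum_congr rfl fun i hi => ?_
    by_cases hik : i = k
    · subst hik; simp
    · rw [Function.update_of_ne hik, hBeq i (hT hi) hik]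
  have hpm : p ≤ m k := blockPrice_le hD0 hs hAne fun T hT => by
    rw [← hupd T hT]; exact hxW.2.2 T hT
  have hred : B' k = B k ∨ (p = m k ∧ k ∈ P) := by
    rcases hxW.2.1.eq_or_lt with h | hlt
    · exact Or.inl h
    right
    -- As the reduction is minimal, some constraint containing `k` is tight at price `m k`;
    -- otherwise her budget could be raised slightly.
    obtain ⟨T, hTA, hkT, hT⟩ : ∃ T ⊆ A, k ∈ T ∧
        ∑ i ∈ T, B' i = m k * (capacity D (s + T.card) - capacity D s) := by
      by_contra! hcon
      have hev : ∀ᶠ x in nhdsWithin (B' k) (Set.Ioi (B' k)), x < B k ∧ ∀ T : Finset ι,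
          T ⊆ A → k ∈ T → ∑ i ∈ T, Function.update B k x i <
            m k * (capacity D (s + T.card) - capacity D s) := by
        apply nhdsWithin_le_nhds
        refine (eventually_lt_nhds hlt).and ?_
        have : ∀ᶠ x in nhds (B' k), ∀ T ∈ A.powerset, k ∈ T →
            ∑ i ∈ T, Function.update B k x i <
              m k * (capacity D (s + T.card) - capacity D s) := by
          refine (Filter.eventually_all_finset _).2 fun T hT => ?_
          rw [Finset.mem_powerset] at hT
          by_cases hkT : k ∈ T
          · have h := lt_of_le_of_ne (hxW.2.2 T hT)
              (by rw [hupd T hT]; exact hcon T hT hkT)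
            filter_upwards [(hcont T).continuousAt.eventually_lt continuousAt_const h]
              with x hx _ using hx
          · exact Filter.Eventually.of_forall fun x h => absurd h hkT
        filter_upwards [this] with x hx T hT using hx T (Finset.mem_powerset.2 hT)
      obtain ⟨x, ⟨hx1, hx2⟩, hx⟩ := (hev.and self_mem_nhdsWithin).exists
      have hx' : B' k < x := hx
      have hxW' : x ∈ W := by
        refine ⟨hxW.1.trans hx'.le, hx1.le, fun T hT => ?_⟩
        by_cases hkT : k ∈ T
        · exact (hx2 T hT hkT).le
        · rw [Finset.sum_update_of_notMem hkT]
          exact hpre' T hT hkT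
      have := le_csSup hWbdd hxW'
      rw [← hBk] at this
      linarith
    have hpk : p = m k := by
      refine le_antisymm hpm ?_
      have h := hsum_le T hTA
      rw [hT] at h
      exact le_of_mul_le_mul_right h (hG (Finset.card_pos.2 ⟨k, hkT⟩))
    refine ⟨hpk, ?_⟩
    by_contra hkP
    -- If `k` were outside `P`, uncrossing the sets `P` and `T`, both tight at price `p`, would make
    -- the larger set `P ∪ T` tight too, against the maximal length of the block.
    have hlt' : P.card < (P ∪ T).card := Finset.card_lt_card
      (Finset.ssubset_iff_of_subset Finset.subset_union_left |>.2
        ⟨k, Finset.mem_union_right _ hkT, hkP⟩)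
    have e1 := hsum_lt (P ∪ T) (Finset.union_subset hPA hTA) hlt'
    have e2 := hsum_le (P ∩ T) (Finset.inter_subset_left.trans hPA)
    have e3 := Finset.sum_union_inter (s₁ := P) (s₂ := T) (f := B')
    have e4 := mul_le_mul_of_nonneg_left (capacity_submodular hD hD0 s P T)
      (show 0 ≤ p from hpk ▸ (hm k).le)
    rw [← hpk] at hT
    linarith
  have hppos : 0 < p := by
    rcases hred with h | h
    · have h2 := hsum_le {k} (by simpa using hkA)
      simp only [Finset.sum_singleton, Finset.card_singleton] at h2
      rw [h] at h2
      exact pos_of_mul_pos_left ((hB k).trans_le h2) (hG le_rfl).le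
    · rw [h.1]; exact hm k
  refine ⟨k, hAR, hkA, hmem, hppos, hpm, ?_, ?_, hBeq, hred, ?_, ?_, hPA, ?_, hPsum, hsum_le,
    hsum_lt⟩
  · intro i hi
    by_cases hik : i = k
    · rw [hik]; exact hxW.1
    · rw [hBeq i hi hik]; exact (hB i).le
  · intro i hi
    by_cases hik : i = k
    · rw [hik]; exact hxW.2.1
    · exact (hBeq i hi hik).le
  · intro i hi hiA
    rcases hred with h | h
    · refine (hout i hi hiA).trans (blockPrice_le hD0 hs hAne fun T hT => ?_)
      refine le_of_eq_of_le (Finset.sum_congr rfl fun j hj => ?_) (hsum_le T hT)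
      by_cases hjk : j = k
      · rw [hjk, h]
      · exact (hBeq j (hT hj) hjk).symm
    · rw [h.1]
      have hik : ¬ (i = k ∨ Precedes m i k) := fun h => hiA ((hmem i hi).2 h)
      rw [not_or] at hik
      exact ((Precedes.total m hik.1).resolve_left hik.2).le
  · intro i hi hiA
    obtain ⟨⟨e1, -⟩, e2⟩ := blockLength_spec (D := D) (B := B) (s := s) hAne
    have e3 := card_top B e2
    refine ⟨top B A (blockLength D B A s), top_subset _ _ _, Finset.card_pos.1 (by omega), ?_⟩
    rw [sum_top_blockLength hD0 hs hAne, e3]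
    exact mul_le_mul_of_nonneg_right (hout i hi hiA) (hG e1).le
  · exact Finset.card_pos.1 (by omega)

end Round

/-! ### Invariants and outcome of the price-setting mechanism. -/

section PriceSetting

variable {ι : Type*} [LinearOrder ι] {n' : ℕ} {D : Fin n' → ℝ} {m B : ι → ℝ}

/-- The condition under which the price-setting mechanism stops. -/
def PSDone (D : Fin n' → ℝ) (σ : PSState ι) : Prop :=
  σ.remaining = ∅ ∨ ∀ j, σ.used ≤ j → padded D j = 0

theorem psRound_of_done {σ : PSState ι} (h : PSDone D σ) : psRound D m B σ = σ :=
  if_pos h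

/-- The outcome of the price-setting mechanism: the clicks `c` and prices `p` are within the bids,
the budgets and the capacities; every bidder `i` lies in a set whose capacity is exhausted and whose
other members have prices of at least hers; and unless `i` exhausts her budget, these members
precede her in the greedy mechanism even when she bids her true value. -/
structure IsPSOutcome (D : Fin n' → ℝ) (m B c p : ι → ℝ) : Prop where
  clicks_nonneg : ∀ i, 0 ≤ c i
  price_nonneg : ∀ i, 0 ≤ p i
  price_le : ∀ i, p i ≤ m i
  mul_le : ∀ i, c i * p i ≤ B i
  clicks_eq_zero : ∀ i, p i = 0 → c i = 0
  sum_le : ∀ T : Finset ι, ∑ i ∈ T, c i ≤ capacity D T.card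
  support : ∀ i, ∃ X : Finset ι, i ∈ X ∧ ∑ j ∈ X, c j = capacity D X.card ∧
    (∀ j ∈ X, p i ≤ p j) ∧ ((0 < p i ∧ c i * p i = B i) ∨
      ∀ j ∈ X, j ≠ i → m i ≤ p j ∧ (p j = m j → m j = m i → j < i))

variable [Fintype ι]

/-- The properties of the states of the price-setting mechanism. The bidders `U` are those that have
been considered for a block so far; they form an initial segment in the order of the bids. -/
structure PSInvariant (D : Fin n' → ℝ) (m B : ι → ℝ) (σ : PSState ι) (U : Finset ι) : Prop where
  used_add : σ.used + σ.remaining.card = Fintype.card ι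
  clicks_nonneg : ∀ i, 0 ≤ σ.clicks i
  clicks_eq_zero : ∀ i ∈ σ.remaining, σ.clicks i = 0
  price_eq_zero : ∀ i ∈ σ.remaining, σ.price i = 0
  price_pos : ∀ i ∉ σ.remaining, 0 < σ.price i
  price_le : ∀ i ∉ σ.remaining, σ.price i ≤ m i
  mul_le : ∀ i, σ.clicks i * σ.price i ≤ B i
  sum_le : ∀ T : Finset ι, ∑ i ∈ T, σ.clicks i ≤ capacity D T.card
  sum_eq : ∑ i, σ.clicks i = capacity D σ.used
  support : ∀ i ∉ σ.remaining, ∃ X : Finset ι, i ∈ X ∧ (∀ j ∈ X, j ∉ σ.remaining) ∧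
    ∑ j ∈ X, σ.clicks j = capacity D X.card ∧ (∀ j ∈ X, σ.price i ≤ σ.price j) ∧
    (σ.clicks i * σ.price i = B i ∨ ∀ j ∈ X, j ≠ i →
      m i ≤ σ.price j ∧ (σ.price j = m j → m j = m i → j < i))
  closed : ∀ i ∈ U, ∀ j, Precedes m j i → j ∈ U
  alloc_mem : ∀ i ∉ σ.remaining, i ∈ U
  sum_lt : ∀ j ∉ σ.remaining, ∀ T ⊆ U, T ⊆ σ.remaining → T.Nonempty →
    ∑ i ∈ T, B i < σ.price j * (capacity D (σ.used + T.card) - capacity D σ.used)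
  out_le : ∀ i ∉ U, ∀ j ∉ σ.remaining, m i ≤ σ.price j
  exists_le : ∀ i ∈ U, ∃ j ∉ σ.remaining, σ.price j ≤ m i

theorem PSInvariant.init (hB : ∀ i, 0 < B i) (hD0 : ∀ j, 0 ≤ D j) :
    PSInvariant D m B ⟨Finset.univ, 0, fun _ => 0, fun _ => 0⟩ ∅ := by
  constructor <;> simp [capacity_zero, fun i => (hB i).le]
  intro T
  exact (capacity_zero (D := D)).symm.le.trans (capacity_mono hD0 (Nat.zero_le _))

/-- The heart is that the new price is at most all earlier ones. If `k` was considered before,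
`sum_lt` says that the remaining considered bidders support only strictly lower prices; if `k` is
new, then `p ≤ m k`, and `out_le` bounds `m k` by the earlier prices. The set of all bidders
allocated so far then serves as the tight set of each member of the new block. -/
theorem PSInvariant.step (hD : StrictAnti D) (hD0 : ∀ j, 0 ≤ D j) {σ σ' : PSState ι}
    {U A P : Finset ι} {B' : ι → ℝ} {p : ℝ} {k : ι} (h : PSInvariant D m B σ U)
    (hs : 0 < padded D σ.used) (hb : IsPriceBlock D m B σ.remaining σ.used A P B' p k)
    (hrem : ∀ i, i ∈ σ'.remaining ↔ i ∈ σ.remaining ∧ i ∉ P) (hused : σ'.used = σ.used + P.card)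
    (hc : ∀ i ∈ P, σ'.clicks i = B' i / p) (hc' : ∀ i ∉ P, σ'.clicks i = σ.clicks i)
    (hp : ∀ i ∈ P, σ'.price i = p) (hp' : ∀ i ∉ P, σ'.price i = σ.price i) :
    PSInvariant D m B σ' (U ∪ A) := by
  classical
  have hPR : P ⊆ σ.remaining := hb.block_subset.trans hb.subset
  have hnP : ∀ i ∉ σ.remaining, i ∉ P := fun i hi hiP => hi (hPR hiP)
  have hcases : ∀ i, i ∉ σ'.remaining ↔ i ∉ σ.remaining ∨ i ∈ P := fun i => by
    rw [hrem]; tauto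
  have hpos := hb.price_pos
  have hG : ∀ {t : ℕ}, 1 ≤ t → 0 < capacity D (σ.used + t) - capacity D σ.used :=
    fun ht => capacity_sub_pos hD0 hs ht
  have hsplit : ∀ T : Finset ι, ∑ i ∈ T, σ'.clicks i =
      (∑ i ∈ T ∩ P, B' i) / p + ∑ i ∈ T \ P, σ.clicks i := by
    intro T
    rw [← Finset.sum_inter_add_sum_sdiff T P, Finset.sum_div]
    congr 1
    · exact Finset.sum_congr rfl fun i hi => hc i (Finset.mem_inter.1 hi).2
    · exact Finset.sum_congr rfl fun i hi => hc' i (Finset.mem_sdiff.1 hi).2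
  have hbefore : ∀ i ∈ σ.remaining, i ∉ A → ∀ j ∈ A, Precedes m j i := by
    intro i hi hiA j hj
    have h1 := mt (hb.mem_iff i hi).2 hiA
    rw [not_or] at h1
    have h2 := (Precedes.total m h1.1).resolve_left h1.2
    rcases (hb.mem_iff j (hb.subset hj)).1 hj with rfl | h3
    · exact h2
    · exact h3.trans h2
  -- Bidders considered earlier are considered again. If `i` were left out, the stopping rule would
  -- give a set `T` before her with ratio at least `m i`; but `T` lies in `U`, so its ratio is below
  -- some earlier price that is at most `m i`.
  have hUA : ∀ i ∈ U, i ∈ σ.remaining → i ∈ A := by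
    intro i hiU hi
    by_contra hiA
    obtain ⟨T, hTA, hTne, hT⟩ := hb.out_exists i hi hiA
    obtain ⟨j, hj, hji⟩ := h.exists_le i hiU
    have h1 := h.sum_lt j hj T (fun e he => h.closed i hiU e (hbefore i hi hiA e (hTA he)))
      (hTA.trans hb.subset) hTne
    have h2 := mul_le_mul_of_nonneg_right hji (hG hTne.card_pos).le
    linarith
  have hplt : k ∈ U → ∀ j ∉ σ.remaining, p < σ.price j := by
    intro hkU j hj
    have hAU : A ⊆ U := fun e he => by
      rcases (hb.mem_iff e (hb.subset he)).1 he with rfl | h1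
      · exact hkU
      · exact h.closed k hkU e h1
    have h1 := h.sum_lt j hj P (hb.block_subset.trans hAU) hPR hb.block_nonempty
    have h2 := Finset.sum_le_sum fun i hi => hb.budget_le i (hb.block_subset hi)
    rw [hb.block_sum] at h2
    exact lt_of_mul_lt_mul_right (h2.trans_lt h1) (hG hb.block_nonempty.card_pos).le
  have hple : ∀ j ∉ σ.remaining, p ≤ σ.price j := by
    intro j hj
    by_cases hkU : k ∈ U
    · exact (hplt hkU j hj).le
    · exact hb.price_le.trans (h.out_le k hkU j hj)
  have hple' : ∀ j ∉ σ'.remaining, p ≤ σ'.price j := by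
    intro j hj
    rcases (hcases j).1 hj with hj | hj
    · rw [hp' j (hnP j hj)]; exact hple j hj
    · rw [hp j hj]
  have hmA : ∀ i ∈ A, p ≤ m i := by
    intro i hi
    rcases (hb.mem_iff i (hb.subset hi)).1 hi with rfl | h1
    · exact hb.price_le
    · exact hb.price_le.trans h1.le
  have hused_add : σ'.used + σ'.remaining.card = Fintype.card ι := by
    have : σ'.remaining = σ.remaining \ P := by ext i; rw [hrem, Finset.mem_sdiff]
    rw [this, hused, Finset.card_sdiff_of_subset hPR, ← h.used_add]
    have := Finset.card_le_card hPR
    omega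
  have hzero : ∀ i ∈ σ'.remaining, σ'.clicks i = 0 := by
    intro i hi
    rw [hrem] at hi
    rw [hc' i hi.2, h.clicks_eq_zero i hi.1]
  have hsum_eq : ∑ i, σ'.clicks i = capacity D σ'.used := by
    have h1 : ∑ i ∈ Finset.univ \ P, σ.clicks i = ∑ i, σ.clicks i := by
      apply Finset.sum_subset (Finset.subset_univ _)
      intro i _ hi
      exact h.clicks_eq_zero i (hPR (by simpa using hi))
    rw [hsplit, h1, h.sum_eq, Finset.univ_inter, hb.block_sum, hused,
      mul_div_cancel_left₀ _ hpos.ne']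
    ring
  refine ⟨hused_add, ?_, hzero, ?_, ?_, ?_, ?_, ?_, hsum_eq, ?_, ?_, ?_, ?_, ?_, ?_⟩
  · intro i
    by_cases hi : i ∈ P
    · rw [hc i hi]
      exact div_nonneg (hb.budget_nonneg i (hb.block_subset hi)) hpos.le
    · rw [hc' i hi]; exact h.clicks_nonneg i
  · intro i hi
    rw [hrem] at hi
    rw [hp' i hi.2, h.price_eq_zero i hi.1]
  · exact fun i hi => hpos.trans_le (hple' i hi)
  · intro i hi
    rcases (hcases i).1 hi with hi | hi
    · rw [hp' i (hnP i hi)]; exact h.price_le i hi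
    · rw [hp i hi]; exact hmA i (hb.block_subset hi)
  · intro i
    by_cases hi : i ∈ P
    · rw [hc i hi, hp i hi, div_mul_cancel₀ _ hpos.ne']
      exact hb.budget_le i (hb.block_subset hi)
    · rw [hc' i hi, hp' i hi]; exact h.mul_le i
  · intro T
    have h1 : ∑ i ∈ T \ P, σ.clicks i = ∑ i ∈ (T \ P) \ σ.remaining, σ.clicks i := by
      symm
      apply Finset.sum_subset Finset.sdiff_subset
      intro i hi hi'
      refine h.clicks_eq_zero i ?_
      by_contra hiR
      exact hi' (Finset.mem_sdiff.2 ⟨hi, hiR⟩)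
    have h2 := h.sum_le ((T \ P) \ σ.remaining)
    have h3 : ((T \ P) \ σ.remaining).card ≤ σ.used := by
      have h4 : ((T \ P) \ σ.remaining).card ≤ σ.remainingᶜ.card := by
        apply Finset.card_le_card
        intro i hi
        exact Finset.mem_compl.2 (Finset.mem_sdiff.1 hi).2
      rw [Finset.card_compl, ← h.used_add] at h4
      omega
    -- Concavity: the increment that bounds the new block, taken after all used slots, is at most
    -- the increment after the fewer old members of `T`.
    have h4 := capacity_add_sub_le hD hD0 h3 (T ∩ P).card
    have h5 : (∑ i ∈ T ∩ P, B' i) / p ≤ capacity D (σ.used + (T ∩ P).card) -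
        capacity D σ.used := by
      rw [div_le_iff₀ hpos, mul_comm]
      exact hb.sum_le _ (Finset.inter_subset_right.trans hb.block_subset)
    have h6 : ((T \ P) \ σ.remaining).card + (T ∩ P).card ≤ T.card := by
      have := Finset.card_le_card (Finset.sdiff_subset (s := T \ P) (t := σ.remaining))
      have := Finset.card_inter_add_card_sdiff T P
      omega
    have h7 := capacity_mono hD0 h6
    rw [hsplit, h1]
    linarith
  · intro i hi
    rcases (hcases i).1 hi with hi | hi
    · obtain ⟨X, hiX, hX, hXt, hXp, hX'⟩ := h.support i hi
      have hXP : ∀ j ∈ X, j ∉ P := fun j hj => hnP j (hX j hj)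
      refine ⟨X, hiX, fun j hj => (hcases j).2 (Or.inl (hX j hj)), ?_, ?_, ?_⟩
      · rw [← hXt]
        exact Finset.sum_congr rfl fun j hj => hc' j (hXP j hj)
      · intro j hj
        rw [hp' i (hXP i hiX), hp' j (hXP j hj)]
        exact hXp j hj
      · rw [hc' i (hXP i hiX), hp' i (hXP i hiX)]
        refine hX'.imp id fun hX' j hj hji => ?_
        rw [hp' j (hXP j hj)]
        exact hX' j hj hji
    · refine ⟨σ'.remainingᶜ, by simp [hcases, hi], fun j hj => by simpa using hj, ?_, ?_, ?_⟩
      · rw [Finset.card_compl, ← hused_add, Nat.add_sub_cancel, ← hsum_eq]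
        apply Finset.sum_subset (Finset.subset_univ _)
        intro j _ hj
        exact hzero j (by simpa using hj)
      · intro j hj
        rw [hp i hi]
        exact hple' j (by simpa using hj)
      · rw [hc i hi, hp i hi, div_mul_cancel₀ _ hpos.ne']
        by_cases hik : i = k
        · subst hik
          refine hb.reduced.imp id fun hr j hj hji => ?_
          rw [Finset.mem_compl, hcases] at hj
          rcases hj with hj | hj
          · rw [hp' j (hnP j hj), ← hr.1]
            refine ⟨hple j hj, fun h1 h2 => ?_⟩
            -- Tie-breaking with an earlier block: had `i` been considered before, `p` would be
            -- strictly below `σ.price j`, against the equality of prices. So `i` is new, and `j`,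
            -- in the initial segment `U`, precedes her.
            have hiU : i ∉ U := fun hiU => by
              have := hplt hiU j hj
              linarith [hr.1]
            have hpre := (Precedes.total m hji).resolve_right
              fun h3 => hiU (h.closed j (h.alloc_mem j hj) i h3)
            rcases hpre with h3 | h3
            · linarith [hr.1]
            · exact h3.2
          · rw [hp j hj]
            refine ⟨hr.1.ge, fun _ h2 => ?_⟩
            rcases ((hb.mem_iff j (hPR hj)).1 (hb.block_subset hj)).resolve_left hji with h3 | h3
            · linarith
            · exact h3.2
        · exact Or.inl (hb.budget_eq i (hb.block_subset hi) hik)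
  · intro i hi j hji
    rcases Finset.mem_union.1 hi with hi | hi
    · exact Finset.mem_union_left _ (h.closed i hi j hji)
    · by_cases hj : j ∈ σ.remaining
      · refine Finset.mem_union_right _ ((hb.mem_iff j hj).2 (Or.inr ?_))
        rcases (hb.mem_iff i (hb.subset hi)).1 hi with rfl | h1
        · exact hji
        · exact hji.trans h1
      · exact Finset.mem_union_left _ (h.alloc_mem j hj)
  · intro i hi
    rcases (hcases i).1 hi with hi | hi
    · exact Finset.mem_union_left _ (h.alloc_mem i hi)
    · exact Finset.mem_union_right _ (hb.block_subset hi)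
  · intro j hj T hTU hTR hTne
    have hTA : T ⊆ A := by
      intro e he
      have h1 := (hrem e).1 (hTR he)
      rcases Finset.mem_union.1 (hTU he) with h2 | h2
      · exact hUA e h2 h1.1
      · exact h2
    have hdisj : Disjoint P T := Finset.disjoint_right.2 fun e he => ((hrem e).1 (hTR he)).2
    have h1 := hb.sum_lt (P ∪ T) (Finset.union_subset hb.block_subset hTA) (by
      rw [Finset.card_union_of_disjoint hdisj]
      have := hTne.card_pos
      omega)
    rw [Finset.card_union_of_disjoint hdisj, Finset.sum_union hdisj, hb.block_sum] at h1
    -- A bidder with a reduced budget is in `P`, hence not in `T`.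
    have h2 : ∑ i ∈ T, B' i = ∑ i ∈ T, B i := by
      refine Finset.sum_congr rfl fun i hi => ?_
      by_cases hik : i = k
      · subst hik
        exact hb.reduced.resolve_right fun hr => ((hrem i).1 (hTR hi)).2 hr.2
      · exact hb.budget_eq i (hTA hi) hik
    have h3 := mul_le_mul_of_nonneg_right (hple' j hj) (sub_nonneg.2 (capacity_mono hD0
      (Nat.le_add_right σ'.used T.card)))
    rw [hused] at h3 ⊢
    rw [← add_assoc] at h1
    linarith
  · intro i hi j hj
    rw [Finset.mem_union, not_or] at hi
    rcases (hcases j).1 hj with hj | hj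
    · rw [hp' j (hnP j hj)]; exact h.out_le i hi.1 j hj
    · rw [hp j hj]
      refine hb.out_le i ?_ hi.2
      by_contra hiR
      exact hi.1 (h.alloc_mem i hiR)
  · intro i hi
    rcases Finset.mem_union.1 hi with hi | hi
    · obtain ⟨j, hj, hji⟩ := h.exists_le i hi
      exact ⟨j, (hcases j).2 (Or.inl hj), by rw [hp' j (hnP j hj)]; exact hji⟩
    · obtain ⟨j, hj⟩ := hb.block_nonempty
      exact ⟨j, (hcases j).2 (Or.inr hj), by rw [hp j hj]; exact hmA i hi⟩

theorem PSInvariant.psRound (hD : StrictAnti D) (hD0 : ∀ j, 0 ≤ D j) (hm : ∀ i, 0 < m i)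
    (hB : ∀ i, 0 < B i) {σ : PSState ι} {U : Finset ι} (h : PSInvariant D m B σ U)
    (hdone : ¬ PSDone D σ) :
    (∃ U', PSInvariant D m B (psRound D m B σ) U') ∧
      (AdSlots.psRound D m B σ).remaining.card < σ.remaining.card := by
  classical
  have hdone' := hdone
  rw [PSDone, not_or] at hdone'
  have hR : σ.remaining.Nonempty := Finset.nonempty_iff_ne_empty.2 hdone'.1
  have hs : 0 < padded D σ.used := by
    by_contra h0
    refine hdone'.2 fun j hj => le_antisymm ?_ (padded_nonneg hD0 j)
    exact (padded_antitone hD hD0 hj).trans (not_lt.1 h0)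
  obtain ⟨k, hb⟩ := isPriceBlock_psRound (m := m) (B := B) hD hD0 hm hB hR hs
  have hcard := card_top (reducedBudget D m B σ.remaining σ.used)
    (blockLength_spec (D := D) (B := reducedBudget D m B σ.remaining σ.used) (s := σ.used)
      ⟨k, hb.last_mem⟩).2
  have hround : AdSlots.psRound D m B σ = _ := if_neg hdone
  have hstep := h.step (σ' := AdSlots.psRound D m B σ) hD hD0 hs hb
    (fun i => by rw [hround]; simp only [Finset.mem_sdiff])
    (by rw [hround, hcard])
    (fun i hi => by rw [hround]; exact if_pos hi) (fun i hi => by rw [hround]; exact if_neg hi)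
    (fun i hi => by rw [hround]; exact if_pos hi) (fun i hi => by rw [hround]; exact if_neg hi)
  refine ⟨⟨_, hstep⟩, Finset.card_lt_card ?_⟩
  rw [hround]
  exact Finset.sdiff_ssubset (hb.block_subset.trans hb.subset) hb.block_nonempty

theorem exists_psInvariant_psFinal (hD : StrictAnti D) (hD0 : ∀ j, 0 ≤ D j) (hm : ∀ i, 0 < m i)
    (hB : ∀ i, 0 < B i) : ∃ U, PSInvariant D m B (psFinal D m B) U ∧ PSDone D (psFinal D m B) := by
  have key : ∀ r : ℕ, ∃ U, PSInvariant D m B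
      ((psRound D m B)^[r] ⟨Finset.univ, 0, fun _ => 0, fun _ => 0⟩) U ∧
      (PSDone D ((psRound D m B)^[r] ⟨Finset.univ, 0, fun _ => 0, fun _ => 0⟩) ∨
        ((psRound D m B)^[r] ⟨Finset.univ, 0, fun _ => 0, fun _ => 0⟩).remaining.card + r ≤
          Fintype.card ι) := by
    intro r
    induction r with
    | zero => exact ⟨∅, PSInvariant.init hB hD0, Or.inr (by simp)⟩
    | succ r ih =>
      obtain ⟨U, hU, hr⟩ := ih
      rw [Function.iterate_succ_apply']
      by_cases hdone : PSDone D ((psRound D m B)^[r] ⟨Finset.univ, 0, fun _ => 0, fun _ => 0⟩)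
      · rw [psRound_of_done hdone]
        exact ⟨U, hU, Or.inl hdone⟩
      · obtain ⟨⟨U', hU'⟩, hlt⟩ := hU.psRound hD hD0 hm hB hdone
        refine ⟨U', hU', Or.inr ?_⟩
        have := hr.resolve_left hdone
        omega
  obtain ⟨U, hU, hr⟩ := key (Fintype.card ι)
  refine ⟨U, hU, ?_⟩
  rcases hr with hr | hr
  · exact hr
  · exact Or.inl (Finset.card_eq_zero.1 (by rw [psFinal]; omega))

theorem isPSOutcome (hD : StrictAnti D) (hD0 : ∀ j, 0 ≤ D j) (hm : ∀ i, 0 < m i)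
    (hB : ∀ i, 0 < B i) : IsPSOutcome D m B (psClicks D m B) (psPrice D m B) := by
  classical
  obtain ⟨U, h, hdone⟩ := exists_psInvariant_psFinal hD hD0 hm hB
  unfold psClicks psPrice
  generalize psFinal D m B = σ at h hdone
  refine ⟨h.clicks_nonneg, fun i => ?_, fun i => ?_, h.mul_le, fun i hi => ?_, h.sum_le,
    fun i => ?_⟩ <;> by_cases hiR : i ∈ σ.remaining
  · exact (h.price_eq_zero i hiR).ge
  · exact (h.price_pos i hiR).le
  · rw [h.price_eq_zero i hiR]; exact (hm i).le
  · exact h.price_le i hiR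
  · exact h.clicks_eq_zero i hiR
  · exact absurd hi (h.price_pos i hiR).ne'
  · have hz : padded D σ.used = 0 := by
      rcases hdone with h1 | h1
      · rw [h1] at hiR; exact absurd hiR (Finset.notMem_empty i)
      · exact h1 _ le_rfl
    -- Otherwise `sum_lt` for `{i}` would bound `B i` strictly by the price times a zero increment.
    -- So a leftover bidder was never considered, and her bid is at most every block price.
    have hiU : i ∉ U := fun hiU => by
      obtain ⟨j, hj, -⟩ := h.exists_le i hiU
      have h1 := h.sum_lt j hj {i} (by simpa using hiU) (by simpa using hiR) (by simp)
      rw [Finset.card_singleton, capacity_succ, hz, Finset.sum_singleton] at h1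
      linarith [hB i]
    have hni : i ∉ σ.remainingᶜ := by simpa using hiR
    -- The allocated bidders exhaust the used slots; adding `i` keeps the set tight since the next
    -- slot has no clicks.
    refine ⟨insert i σ.remainingᶜ, Finset.mem_insert_self _ _, ?_, ?_, Or.inr ?_⟩
    · have h1 : (σ.remainingᶜ).card = σ.used := by
        rw [Finset.card_compl, ← h.used_add, Nat.add_sub_cancel]
      rw [Finset.card_insert_of_notMem hni, h1, capacity_succ, hz, add_zero, ← h.sum_eq]
      apply Finset.sum_subset (Finset.subset_univ _)
      intro j _ hj
      rw [Finset.mem_insert, Finset.mem_compl, not_or, not_not] at hj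
      exact h.clicks_eq_zero j hj.2
    · intro j hj
      rw [h.price_eq_zero i hiR]
      by_cases hjR : j ∈ σ.remaining
      · exact (h.price_eq_zero j hjR).ge
      · exact (h.price_pos j hjR).le
    · intro j hj hji
      have hjR := Finset.mem_compl.1 ((Finset.mem_insert.1 hj).resolve_left hji)
      refine ⟨h.out_le i hiU j hjR, fun _ h2 => ?_⟩
      have hpre := (Precedes.total m hji).resolve_right
        fun h3 => hiU (h.closed j (h.alloc_mem j hjR) i h3)
      rcases hpre with h3 | h3
      · linarith
      · exact h3.2
  · obtain ⟨X, hiX, -, hXt, hXp, hX⟩ := h.support i hiR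
    exact ⟨X, hiX, hXt, hXp, hX.imp (fun h1 => ⟨h.price_pos i hiR, h1⟩) id⟩

end PriceSetting

/-! ### Stability of the outcome under a small increase of the prices. -/

section Equilibrium

variable {ι : Type*} [LinearOrder ι] {n' : ℕ} {D : Fin n' → ℝ} {m B c p : ι → ℝ}
  {η ε' : ℝ}

theorem IsPSOutcome.mul_sub_le (h : IsPSOutcome D m B c p) (hη : 0 ≤ η) (hε' : 0 ≤ ε') {i : ι}
    (hsmall : ε' * c i ≤ p i * η) : (p i + ε') * (c i - η) ≤ B i := by
  nlinarith [h.mul_le i, mul_nonneg hε' hη]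

/-- Exhausting the budget at a price raised by at most `ε'` still buys at least `c i - η` clicks,
because `c i - η` clicks are affordable at `p i + ε'`. Price zero means zero clicks, so nothing is
needed there. -/
theorem IsPSOutcome.sub_le_of_saturated (h : IsPSOutcome D m B c p) (hη : 0 ≤ η)
    (hε' : 0 < ε') {i : ι} (hsmall : p i = 0 ∨ ε' * c i ≤ p i * η) {x : ℝ}
    (hx0 : 0 ≤ x) (hx : B i ≤ min (m i) (p i + ε') * x) : c i - η ≤ x := by
  rcases hsmall with h0 | hsmall
  · rw [h.clicks_eq_zero i h0]; linarith
  · by_contra! hlt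
    have h1 := h.mul_sub_le hη hε'.le hsmall
    have h2 := mul_le_mul_of_nonneg_right (min_le_right (m i) (p i + ε')) hx0
    have h3 := mul_lt_mul_of_pos_left hlt (show 0 < p i + ε' by linarith [h.price_nonneg i])
    linarith

variable [Fintype ι]

/-- No bidder can receive many more clicks than in the price-setting mechanism by deviating. -/
theorem IsPSOutcome.gfpClicks_update_le (h : IsPSOutcome D m B c p) (hD : StrictAnti D)
    (hD0 : ∀ j, 0 ≤ D j) (hB : ∀ i, 0 < B i) (hη : 0 ≤ η) (hε' : 0 < ε')
    (hsmall : ∀ i, p i = 0 ∨ ε' * c i ≤ p i * η) (i : ι) {x y : ℝ} (hy : 0 ≤ y) (hx : x ≤ m i)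
    (hbudget : gfpClicks D (Function.update (fun j => min (m j) (p j + ε')) i x)
      (Function.update B i y) i * x ≤ B i) :
    gfpClicks D (Function.update (fun j => min (m j) (p j + ε')) i x) (Function.update B i y) i ≤
      c i + Fintype.card ι * η := by
  have hB' : ∀ j, 0 ≤ Function.update B i y j := fun j => by
    by_cases hj : j = i
    · subst hj; simpa using hy
    · rw [Function.update_of_ne hj]; exact (hB j).le
  have hg0 := gfpClicks_nonneg
    (b := Function.update (fun j => min (m j) (p j + ε')) i x) hD hD0 hB' i
  have hle : ∀ j, p j ≤ min (m j) (p j + ε') := fun j => le_min (h.price_le j) (by linarith)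
  obtain ⟨X, hiX, hXt, hXp, hX⟩ := h.support i
  have key : (∀ j ∈ X, j ≠ i →
      Precedes (Function.update (fun j => min (m j) (p j + ε')) i x) j i) →
      gfpClicks D (Function.update (fun j => min (m j) (p j + ε')) i x) (Function.update B i y) i
        ≤ c i + Fintype.card ι * η := fun hprec =>
    gfpClicks_le_of_tight hD hD0 hB' h.sum_le hiX hXt hη hprec fun j hj hji hsat => by
      rw [Function.update_of_ne hji, Function.update_of_ne hji] at hsat
      exact h.sub_le_of_saturated hη hε' (hsmall j) (gfpClicks_nonneg hD hD0 hB' j) hsat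
  rcases hX with ⟨hp, hsat⟩ | hX
  · rcases lt_or_ge x (p i) with hxp | hxp
    · refine key fun j hj hji => Or.inl ?_
      rw [Function.update_self, Function.update_of_ne hji]
      exact hxp.trans_le ((hXp j hj).trans (hle j))
    · have h1 := mul_le_mul_of_nonneg_left hxp hg0
      have h2 := le_of_mul_le_mul_right (h1.trans (hbudget.trans hsat.ge)) hp
      have h3 : 0 ≤ (Fintype.card ι : ℝ) * η := by positivity
      linarith
  · refine key fun j hj hji => ?_
    obtain ⟨h1, h2⟩ := hX j hj hji
    unfold Precedes
    rw [Function.update_self, Function.update_of_ne hji]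
    -- In a tie the whole chain `x ≤ m i ≤ p j ≤ min (m j) (p j + ε')` is an equality. As `ε' > 0`,
    -- the minimum is `m j`, so the tie-breaking clause of `support` applies.
    rcases (hx.trans (h1.trans (hle j))).lt_or_eq with h3 | h3
    · exact Or.inl h3
    · refine Or.inr ⟨h3.symm, ?_⟩
      have h4 := hle j
      have h5 : min (m j) (p j + ε') = p j := by linarith
      have h6 : p j = m j := by
        rcases min_choice (m j) (p j + ε') with h7 | h7 <;> linarith
      exact h2 h6 (by linarith)

theorem IsPSOutcome.exists_small (h : IsPSOutcome D m B c p) (hη : 0 < η) :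
    ∃ δ : ℝ, 0 < δ ∧ ∀ ε' : ℝ, 0 < ε' → ε' < δ → ∀ i, p i = 0 ∨ ε' * c i ≤ p i * η := by
  have hev : ∀ᶠ ε' in nhds (0 : ℝ), ∀ i, p i = 0 ∨ ε' * c i ≤ p i * η := by
    refine Filter.eventually_all.2 fun i => ?_
    rcases (h.price_nonneg i).eq_or_lt with h0 | h0
    · exact Filter.Eventually.of_forall fun _ => Or.inl h0.symm
    · have h1 : (0 : ℝ) * c i < p i * η := by rw [zero_mul]; positivity
      filter_upwards [ContinuousAt.eventually_lt (f := fun x : ℝ => x * c i)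
        (g := fun _ => p i * η) (by fun_prop) (by fun_prop) h1] with x hx
      exact Or.inr hx.le
  obtain ⟨δ, hδ, hball⟩ := Metric.eventually_nhds_iff.1 hev
  refine ⟨δ, hδ, fun ε' h1 h2 => hball ?_⟩
  rwa [Real.dist_eq, sub_zero, abs_of_pos h1]

end Equilibrium

end AdSlots

theorem theorem7 {ι : Type*} [LinearOrder ι] [Fintype ι] {n' : ℕ} (D : Fin n' → ℝ)
    (hD : StrictAnti D) (hD0 : ∀ j, 0 ≤ D j) (m B : ι → ℝ) (hm : ∀ i, 0 < m i)
    (hB : ∀ i, 0 < B i) (ε : ℝ) (hε : 0 < ε) :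
    ∃ δ : ℝ, 0 < δ ∧ ∀ ε' : ℝ, 0 < ε' → ε' < δ →
      AdSlots.IsEpsNash D m B ε (fun i => min (m i) (AdSlots.psPrice D m B i + ε')) B ∧
      ∀ i, |AdSlots.gfpClicks D (fun i => min (m i) (AdSlots.psPrice D m B i + ε')) B i
        - AdSlots.psClicks D m B i| ≤ ε := by
  classical
  have h := AdSlots.isPSOutcome hD hD0 hm hB
  generalize AdSlots.psPrice D m B = p at h ⊢
  generalize AdSlots.psClicks D m B = c at h ⊢
  set n : ℝ := (Fintype.card ι : ℝ) with hn
  have hn0 : 0 ≤ n := Nat.cast_nonneg _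
  -- A deviation yields at most `c i + n * η`, while the profile yields at least `c i - (n ^ 2 + 1)
  -- * η`: up to `n` earlier bidders may each take `n * η` too much, and one more `η` makes up for
  -- the raised price. The coefficient is the sum of both errors.
  obtain ⟨η, hη, hηε⟩ : ∃ η : ℝ, 0 < η ∧ (n ^ 2 + n + 1) * η ≤ ε :=
    ⟨ε / (n ^ 2 + n + 1), by positivity, (mul_div_cancel₀ _ (by positivity)).le⟩
  obtain ⟨δ, hδ, hδ'⟩ := h.exists_small hη
  refine ⟨δ, hδ, fun ε' hε' hεδ => ?_⟩
  have hsmall := hδ' ε' hε' hεδ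
  have hB0 : ∀ i, 0 ≤ B i := fun i => (hB i).le
  set b : ι → ℝ := fun i => min (m i) (p i + ε') with hb
  have hbm : ∀ i, b i ≤ m i := fun i => min_le_left _ _
  have hbud : ∀ i, AdSlots.gfpClicks D b B i * b i ≤ B i := fun i => by
    rw [mul_comm]; exact AdSlots.mul_gfpClicks_le hD hD0 hB0 i
  have hup : ∀ i, AdSlots.gfpClicks D b B i ≤ c i + n * η := fun i => by
    have := h.gfpClicks_update_le hD hD0 hB hη.le hε' hsmall i (x := b i) (y := B i) (hB0 i)
      (hbm i) (by rw [Function.update_eq_self, ← hb, Function.update_eq_self]; exact hbud i)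
    rwa [Function.update_eq_self, ← hb, Function.update_eq_self] at this
  have hlow : ∀ i, c i - (n ^ 2 + 1) * η ≤ AdSlots.gfpClicks D b B i := by
    intro i
    have hg0 := AdSlots.gfpClicks_nonneg (b := b) hD hD0 hB0 i
    by_cases h0 : c i - (n ^ 2 + 1) * η < 0
    · linarith
    rw [not_lt] at h0
    refine (AdSlots.gfpClicks_spec hD hD0 hB0 i).2 _ h0 ?_ fun T hT => ?_
    · rcases hsmall i with h1 | h1
      · rw [h.clicks_eq_zero i h1] at h0
        nlinarith
      · refine le_trans ?_ (h.mul_sub_le hη.le hε'.le h1)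
        have h2 : c i - (n ^ 2 + 1) * η ≤ c i - η := by nlinarith
        exact (mul_le_mul_of_nonneg_right (min_le_right _ _) h0).trans
          (mul_le_mul_of_nonneg_left h2 (by linarith [h.price_nonneg i]))
    · have hi : i ∉ T := fun hi => AdSlots.Precedes.irrefl b i (hT i hi)
      have h1 := Finset.sum_le_sum fun j (_ : j ∈ T) => hup j
      have h2 := h.sum_le (insert i T)
      rw [Finset.sum_insert hi, Finset.card_insert_of_notMem hi] at h2
      rw [Finset.sum_add_distrib, Finset.sum_const, nsmul_eq_mul] at h1
      have h3 : (T.card : ℝ) ≤ n := Nat.cast_le.2 (Finset.card_le_univ T)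
      have h4 := mul_le_mul_of_nonneg_right h3 (mul_nonneg hn0 hη.le)
      nlinarith
  refine ⟨fun i x y _ hy => ?_, fun i => ?_⟩
  · unfold AdSlots.gfpUtility AdSlots.utility
    rw [if_pos (show b i ≤ m i ∧ AdSlots.gfpClicks D b B i * b i ≤ B i from ⟨hbm i, hbud i⟩),
      Function.update_self]
    split_ifs with hcond
    · have h1 := h.gfpClicks_update_le hD hD0 hB hη.le hε' hsmall i hy hcond.1 hcond.2
      rw [← EReal.coe_add, EReal.coe_le_coe_iff]
      have h2 := hlow i
      refine h1.trans ?_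
      rw [← hn]
      linarith
    · exact bot_le
  · rw [abs_le]
    have h1 := hup i
    have h2 := hlow i
    constructor
    · nlinarith
    · nlinarith [mul_nonneg (sq_nonneg n) hη.le]
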